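/- Let $0<|q|<1$. Write $(x;q)_\infty=\prod_{n\ge 0}(1-xq^n)$ and, for $n\in\mathbb Z$, $(x;q)_n=(x;q)_\infty/(q^nx;q)_\infty$, that is, $(x;q)_n=\prod_{j=0}^{n-1}(1-xq^j)$ if $n\ge 0$ and $(x;q)_n=1/\prod_{j=1}^{-n}(1-xq^{-j})$ if $n<0$; put $(x_1,\dots,x_m;q)_n=\prod_i (x_i;q)_n$ for $n\in\mathbb Z\cup\{\infty\}$. Let $$\theta(x)=\frac1{(q;q)_\infty}\sum_{n\in\mathbb Z}(-1)^nq^{n(n-1)/2}x^n\quad(x\ne0),\qquad \theta(x_1,\dots,x_m)=\prod_i\theta(x_i),$$ $$\Omega(x_1,\dots,x_n;a_1,\dots,a_m)=\prod_{i=1}^n\prod_{j=1}^m(x_i/a_j;q)_\infty ,$$ and let $${}_8\psi_8[a;a_3,\dots,a_8;q,w]=\sum_{n\in\mathbb Z}\frac{(a_1,\dots,a_8;q)_n}{(aq/a_1,\dots,aq/a_8;q)_n}\,w^n,\qquad a_1=q\sqrt a,\quad a_2=-q\sqrt a,$$ denote the very-well-poised bilateral series. Let $a,b,c,d,e,h,k,x,z$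 be nonzero complex numbers and put $w=\dfrac{a^3q^2}{bcdehk}$, where $|w|<1$. Assume that the terms of the three series below are well defined (that is, for the upper parameters $a_i$ and lower parameters $b_i=Aq/a_i$ of each series with base $A$, $a_i\ne q^{j}$ for $j\ge1$ and $b_i\neq q^{-j}$ for $j\ge 0$), and that no denominator of the three coefficients below vanishes. Then the three series converge absolutely, and $$\begin{aligned} &\frac{\Omega(q,aq;b,c,d,e,h,k)}{\theta(bx/a,xz/a,bx,xz)}\;{}_8\psi_8[a;b,c,d,e,h,k;q,w]\\ &=\frac{(aq,q/a;q)_\infty}{(b^2x^2q/a,\,aq/b^2x^2;q)_\infty}\,\frac{\Omega(aq/bx,bqx;b,c,d,e,h,k)}{\theta(z/b,bx,bx/a,bx^2z/a)}\\ &\qquad\times{}_8\psi_8\Big[\frac{b^2x^2}a;\frac{b^2x}a,\frac{bcx}a,\frac{bdx}a,\frac{bex}a,\frac{bhx}a,\frac{bkx}a;q,w\Big]\\ &\quad+\frac{(aq,q/a;q)_\infty}{(x^2z^2q/a,\,aq/x^2z^2;q)_\infty}\,\frac{\Omega(xzq,aq/xz;b,c,d,e,h,k)}{\theta(b/z,xz/a,bx^2z/a,xz)}\\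 &\qquad\times{}_8\psi_8\Big[\frac{x^2z^2}a;\frac{bxz}a,\frac{cxz}a,\frac{dxz}a,\frac{exz}a,\frac{hxz}a,\frac{kxz}a;q,w\Big]. \end{aligned}$$ -/

import Mathlib

noncomputable section

/-- The infinite `q`-shifted factorial `(x; q)_∞ = ∏_{n ≥ 0} (1 - x q^n)`. -/
def qInf (q x : ℂ) : ℂ := ∏' n : ℕ, (1 - x * q ^ n)

/-- `(x₁, …, x_m; q)_∞ = (x₁; q)_∞ ⋯ (x_m; q)_∞`. -/
def qInfList (q : ℂ) (xs : List ℂ) : ℂ := (xs.map (qInf q)).prod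

/-- The `q`-shifted factorial `(x; q)_n` for an integer `n`:
`∏_{0 ≤ j < n} (1 - x q^j)` if `n ≥ 0` and `1 / ∏_{1 ≤ j ≤ -n} (1 - x q^{-j})` if `n < 0`.
It equals `(x; q)_∞ / (q^n x; q)_∞` whenever the latter is meaningful (`qPoch_eq_div`), and it
also covers the terminating case `x = q^{-m}`, where that quotient reads `0 / 0`. -/
def qPoch (q x : ℂ) : ℤ → ℂ
  | Int.ofNat n => ∏ j ∈ Finset.range n, (1 - x * q ^ j)
  | Int.negSucc n => (∏ j ∈ Finset.range (n + 1), (1 - x * (q ^ (j + 1))⁻¹))⁻¹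

/-- `(x₁, …, x_m; q)_n = (x₁; q)_n ⋯ (x_m; q)_n`. -/
def qPochList (q : ℂ) (xs : List ℂ) (n : ℤ) : ℂ := (xs.map fun x => qPoch q x n).prod

/-- The Jacobi theta function
`θ(x) = (1 / (q; q)_∞) ∑_{n ∈ ℤ} (-1)^n q^{n (n - 1) / 2} x^n`. -/
def qTheta (q x : ℂ) : ℂ :=
  (∑' n : ℤ, (-1 : ℂ) ^ n * q ^ (n * (n - 1) / 2) * x ^ n) / qInf q q

/-- `θ(x₁, …, x_m) = θ(x₁) ⋯ θ(x_m)`. -/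
def qThetaList (q : ℂ) (xs : List ℂ) : ℂ := (xs.map (qTheta q)).prod

/-- `Ω(x₁, …, x_n; a₁, …, a_m) = ∏_i ∏_j (x_i / a_j; q)_∞`. -/
def qOmega (q : ℂ) (xs as : List ℂ) : ℂ :=
  (xs.map fun x => (as.map fun y => qInf q (x / y)).prod).prod

/-- The `n`-th term of the bilateral series `ᵣψᵣ[as; bs; q, z]`. If some entry of `bs` is `q^m`
with `m ≥ 1`, then for `n ≤ -m` the factor `1 / (q^m; q)_n` is `0`, as it should be: here
`(q^m; q)_n` is the inverse of zero, and both inversions are of zero. -/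
def psiTerm (q : ℂ) (as bs : List ℂ) (z : ℂ) (n : ℤ) : ℂ :=
  qPochList q as n / qPochList q bs n * z ^ n

/-- Every term of `ᵣψᵣ[as; bs; q, z]` is well defined, that is, contains no zero factor in a
denominator: neither a factor `1 - a_i q^{-j}`, `j ≥ 1`, (from `(a_i; q)_n` with `n < 0`) nor a
factor `1 - b_i q^j`, `j ≥ 0`, (from `(b_i; q)_n` with `n > 0`) vanishes. -/
def PsiDefined (q : ℂ) (as bs : List ℂ) : Prop :=
  (∀ y ∈ as, ∀ j : ℕ, 1 - y * (q ^ (j + 1))⁻¹ ≠ 0) ∧ ∀ y ∈ bs, ∀ j : ℕ, 1 - y * q ^ j ≠ 0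

/-- Upper parameters `q √a, -q √a, a₃, …, a_r` of the very-well-poised series. The choice of the
square root is immaterial. -/
def vwpUpper (q a : ℂ) (l : List ℂ) : List ℂ :=
  q * a ^ (1 / 2 : ℂ) :: -(q * a ^ (1 / 2 : ℂ)) :: l

/-- Lower parameters of the very-well-poised series, determined by `a_i b_i = a q`. -/
def vwpLower (q a : ℂ) (l : List ℂ) : List ℂ := (vwpUpper q a l).map fun y => a * q / y

/-- The `n`-th term of the very-well-poised `ᵣψᵣ[a; a₃, …, a_r; q, z]`, with
`l = [a₃, …, a_r]`. -/
def vwpPsiTerm (q a : ℂ) (l : List ℂ) (z : ℂ) (n : ℤ) : ℂ :=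
  psiTerm q (vwpUpper q a l) (vwpLower q a l) z n

/-- The very-well-poised bilateral series `ᵣψᵣ[a; a₃, …, a_r; q, z]`. -/
def vwpPsi (q a : ℂ) (l : List ℂ) (z : ℂ) : ℂ := ∑' n : ℤ, vwpPsiTerm q a l z n

/-- Every term of `ᵣψᵣ[a; a₃, …, a_r; q, z]` is well defined. -/
def VwpPsiDefined (q a : ℂ) (l : List ℂ) : Prop :=
  PsiDefined q (vwpUpper q a l) (vwpLower q a l)

end

theorem qInf_multipliable {q : ℂ} (hq : ‖q‖ < 1) (x : ℂ) :
    Multipliable fun n : ℕ => 1 - x * q ^ n := by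
  have h : Summable fun n : ℕ => ‖-(x * q ^ n)‖ := by
    simp only [norm_neg, norm_mul, norm_pow]
    exact (summable_geometric_of_lt_one (norm_nonneg q) hq).mul_left _
  simpa [sub_eq_add_neg] using multipliable_one_add_of_summable h

theorem qInf_eq_mul {q : ℂ} (hq : ‖q‖ < 1) (x : ℂ) (n : ℕ) :
    qInf q x = (∏ j ∈ Finset.range n, (1 - x * q ^ j)) * qInf q (x * q ^ n) := by
  induction n with
  | zero => simp
  | succ n ih =>
    have h : qInf q (x * q ^ n) = (1 - x * q ^ n) * qInf q (x * q ^ (n + 1)) := by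
      unfold qInf
      rw [tprod_eq_zero_mul' (f := fun j : ℕ => 1 - x * q ^ n * q ^ j)]
      · simp only [pow_zero, mul_one]
        congr 2
        funext j
        ring
      · have := qInf_multipliable hq (x * q ^ (n + 1))
        refine this.congr fun j => ?_
        ring
    rw [ih, h, Finset.prod_range_succ]
    ring

/-- `(x; q)_n = (x; q)_∞ / (q^n x; q)_∞` whenever the denominator is not zero. -/
theorem qPoch_eq_div {q : ℂ} (hq0 : 0 < ‖q‖) (hq : ‖q‖ < 1) (x : ℂ) (n : ℤ)
    (h : qInf q (q ^ n * x) ≠ 0) : qPoch q x n = qInf q x / qInf q (q ^ n * x) := by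
  have hq' : q ≠ 0 := norm_pos_iff.mp hq0
  rw [eq_div_iff h]
  cases n with
  | ofNat n =>
    rw [qInf_eq_mul hq x n]
    simp [qPoch, mul_comm]
  | negSucc n =>
    have e : qInf q (q ^ (Int.negSucc n) * x) =
        (∏ j ∈ Finset.range (n + 1), (1 - x * (q ^ (j + 1))⁻¹)) * qInf q x := by
      rw [qInf_eq_mul hq _ (n + 1)]
      congr 1
      · rw [← Finset.prod_range_reflect]
        refine Finset.prod_congr rfl fun j hj => ?_
        have hj' : j ≤ n := by simpa [Nat.lt_succ_iff] using hj
        obtain ⟨k, rfl⟩ := Nat.exists_eq_add_of_le hj'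
        have : j + k + 1 - 1 - j = k := by omega
        rw [this, zpow_negSucc]
        congr 1
        field_simp
        ring
      · rw [zpow_negSucc]
        congr 1
        field_simp
    rw [e] at h ⊢
    simp only [qPoch]
    rw [inv_mul_cancel_left₀ (left_ne_zero_of_mul h)]

/-!
Multiply the very-well-poised series with base `t² / a` and parameters `t y / a`, where `y` runs
through the list `l`, by `t⁻¹ (1 - t² / a) Ω(aq / t, qt; l)`. As a function of `t` the product is
the sum over the orbit `q ^ ℤ t` of translates of one holomorphic kernel, which is odd under
`t ↦ a / t`. The sum inherits this symmetry and is quasi-periodic under `t ↦ q t`, and `2 (N + 1)`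
parameters give it degree `N + 1`. Both symmetries relate the Laurent coefficients to each other:
those of indices `1, …, N` determine all of them, so the functions of this kind form a space of
dimension at most `N` and such a function is recovered from its values at `N` nodes. The Lagrange
basis for nodes `y₁, …, y_N` consists of the functions
`t⁻¹ (t² / a, aq / t²; q)_∞ ∏_{j ≠ k} θ(t y_j / a, y_j / t)`. Evaluating the interpolation formula
at `t = a`, where the base is `a` itself, gives a relation between `N + 1` series, and the theorem
is the case `N = 2` with the nodes `b x` and `x z`.
-/

open Finset Filter Topology

section ShiftedFactorial

variable {q : ℂ}

theorem qInf_eq_one_sub_mul (hq : ‖q‖ < 1) (x : ℂ) : qInf q x = (1 - x) * qInf q (q * x) := by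
  simpa [mul_comm] using qInf_eq_mul hq x 1

theorem norm_prod_one_sub_mul_pow_le (hq : ‖q‖ < 1) (x : ℂ) (n : ℕ) :
    ‖∏ j ∈ range n, (1 - x * q ^ j)‖ ≤ Real.exp (‖x‖ / (1 - ‖q‖)) := by
  have hs := summable_geometric_of_lt_one (norm_nonneg q) hq
  calc ‖∏ j ∈ range n, (1 - x * q ^ j)‖ = ∏ j ∈ range n, ‖1 - x * q ^ j‖ := norm_prod _ _
    _ ≤ ∏ j ∈ range n, Real.exp (‖x‖ * ‖q‖ ^ j) := by
        refine prod_le_prod (fun _ _ => norm_nonneg _) fun j _ => ?_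
        calc ‖1 - x * q ^ j‖ ≤ ‖(1 : ℂ)‖ + ‖x * q ^ j‖ := norm_sub_le _ _
          _ = ‖x‖ * ‖q‖ ^ j + 1 := by simp [add_comm]
          _ ≤ _ := Real.add_one_le_exp _
    _ = Real.exp (‖x‖ * ∑ j ∈ range n, ‖q‖ ^ j) := by rw [← Real.exp_sum, mul_sum]
    _ ≤ Real.exp (‖x‖ * ∑' j : ℕ, ‖q‖ ^ j) := by
        gcongr
        exact hs.sum_le_tsum _ fun _ _ => by positivity
    _ = _ := by rw [tsum_geometric_of_lt_one (norm_nonneg q) hq, div_eq_mul_inv]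

theorem norm_qInf_le (hq : ‖q‖ < 1) (x : ℂ) : ‖qInf q x‖ ≤ Real.exp (‖x‖ / (1 - ‖q‖)) :=
  le_of_tendsto ((qInf_multipliable hq x).hasProd.tendsto_prod_nat).norm
    (Eventually.of_forall fun n => norm_prod_one_sub_mul_pow_le hq x n)

theorem qInf_ne_zero (hq : ‖q‖ < 1) {x : ℂ} (h : ∀ j : ℕ, 1 - x * q ^ j ≠ 0) : qInf q x ≠ 0 := by
  have hs : Summable fun n : ℕ => ‖-(x * q ^ n)‖ := by
    simp only [norm_neg, norm_mul, norm_pow]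
    exact (summable_geometric_of_lt_one (norm_nonneg q) hq).mul_left _
  simpa [qInf, sub_eq_add_neg] using tprod_one_add_ne_zero_of_summable
    (fun n => by simpa [sub_eq_add_neg] using h n) hs

theorem differentiable_qInf (hq : ‖q‖ < 1) : Differentiable ℂ (qInf q) := by
  have hprod : HasProdLocallyUniformlyOn (fun (n : ℕ) (x : ℂ) => 1 + -(x * q ^ n))
      (fun x => ∏' n : ℕ, (1 + -(x * q ^ n))) Set.univ := by
    refine hasProdLocallyUniformlyOn_of_forall_compact isOpen_univ fun K _ hK => ?_
    obtain ⟨C, hC⟩ := hK.isBounded.exists_norm_le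
    refine ((summable_geometric_of_lt_one (norm_nonneg q) hq).mul_left
      C).hasProdUniformlyOn_nat_one_add hK (.of_forall fun n x hx => ?_) fun _ => by fun_prop
    rw [norm_neg, norm_mul, norm_pow]
    gcongr
    exact hC x hx
  have hdiff := hprod.differentiableOn (.of_forall fun _ => by
    simpa [Finset.prod_fn] using DifferentiableOn.finsetProd fun _ _ => by fun_prop) isOpen_univ
  simpa [differentiableOn_univ, qInf, sub_eq_add_neg] using! hdiff

theorem qPoch_zero (x : ℂ) : qPoch q x 0 = 1 := prod_range_zero _

theorem qPoch_add_one {x : ℂ} {n : ℤ} (h : n < 0 → 1 - x * q ^ n ≠ 0) :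
    qPoch q x (n + 1) = (1 - x * q ^ n) * qPoch q x n := by
  rcases n with n | _ | n
  · change qPoch q x (Int.ofNat (n + 1)) = _
    simp [qPoch, prod_range_succ, mul_comm]
  · simpa [qPoch] using! (mul_inv_cancel₀ (h (Int.negSucc_lt_zero 0))).symm
  · change qPoch q x (Int.negSucc n) = _
    have hn := h (Int.negSucc_lt_zero _)
    rw [zpow_negSucc] at hn ⊢
    simp only [qPoch]
    rw [prod_range_succ _ (n + 1), mul_inv, mul_comm, mul_assoc, inv_mul_cancel₀ hn, mul_one]

theorem inv_qPoch_eq {x : ℂ} {n : ℤ} (h : 0 ≤ n → 1 - x * q ^ n ≠ 0) :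
    (qPoch q x n)⁻¹ = (1 - x * q ^ n) * (qPoch q x (n + 1))⁻¹ := by
  rcases n with n | _ | n
  · have hn : 1 - x * q ^ n ≠ 0 := by simpa using h (Int.natCast_nonneg n)
    change _ = _ * (qPoch q x (Int.ofNat (n + 1)))⁻¹
    simp only [qPoch, prod_range_succ, mul_inv, Int.ofNat_eq_natCast, zpow_natCast]
    field_simp
  · simp [qPoch]
  · change _ = _ * (qPoch q x (Int.negSucc n))⁻¹
    simp only [qPoch, inv_inv, zpow_negSucc]
    rw [prod_range_succ _ (n + 1), mul_comm]

theorem qInf_zpow_mul (hq0 : q ≠ 0) (hq : ‖q‖ < 1) {x : ℂ} (h : ∀ j : ℕ, 1 - x * q ^ j ≠ 0)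
    (n : ℤ) : qInf q (q ^ n * x) = qInf q x * (qPoch q x n)⁻¹ := by
  have step (n : ℤ) : qInf q (q ^ n * x) = (1 - x * q ^ n) * qInf q (q ^ (n + 1) * x) := by
    rw [qInf_eq_one_sub_mul hq, zpow_add_one₀ hq0]
    ring_nf
  induction n using Int.induction_on with
  | zero => simp [qPoch_zero]
  | succ n ih =>
    have hn : 1 - x * q ^ (n : ℤ) ≠ 0 := by simpa using h n
    refine mul_left_cancel₀ hn ?_
    rw [← step, ih, inv_qPoch_eq fun _ => hn]
    ring
  | pred n ih =>
    rw [step, sub_add_cancel, ih, inv_qPoch_eq (n := -(n : ℤ) - 1) fun hn => by lia, sub_add_cancel]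
    ring

theorem qPoch_q_mul_div_qPoch (hq0 : q ≠ 0) (hq : ‖q‖ < 1) {x : ℂ}
    (h : ∀ j : ℤ, 1 - x * q ^ j ≠ 0) (n : ℤ) :
    qPoch q (q * x) n / qPoch q x n = (1 - x * q ^ n) / (1 - x) := by
  have qInf_zpow_ne_zero (m : ℤ) : qInf q (q ^ m * x) ≠ 0 := qInf_ne_zero hq fun j => by
    have := h (m + j)
    rwa [zpow_add₀ hq0, zpow_natCast, ← mul_assoc, mul_comm x] at this
  have hx : 1 - x ≠ 0 := by simpa using h 0
  have hqx : qInf q (q * x) ≠ 0 := by simpa using qInf_zpow_ne_zero 1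
  have hn : qInf q (q ^ n * x) ≠ 0 := qInf_zpow_ne_zero n
  have hn1 : qInf q (q ^ n * (q * x)) ≠ 0 := by
    simpa [zpow_add_one₀ hq0, mul_assoc] using qInf_zpow_ne_zero (n + 1)
  rw [qPoch_eq_div (norm_pos_iff.mpr hq0) hq _ _ hn, qPoch_eq_div (norm_pos_iff.mpr hq0) hq _ _ hn1,
    qInf_eq_one_sub_mul hq x, qInf_eq_one_sub_mul hq (q ^ n * x), mul_left_comm q]
  generalize qInf q (q ^ n * (q * x)) = v at hn1 ⊢
  field_simp

theorem triangle_add_one (n : ℤ) : (n + 1) * (n + 1 - 1) / 2 = n * (n - 1) / 2 + n := by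
  rw [show (n + 1) * (n + 1 - 1) = n * (n - 1) + n * 2 by ring,
    Int.add_mul_ediv_right _ _ two_ne_zero]

theorem qInf_div_zpow_mul (hq0 : q ≠ 0) (hq : ‖q‖ < 1) {x : ℂ} (hx : x ≠ 0) {n : ℤ}
    (h : ∀ j < 0, n ≤ j → 1 - x * q ^ j ≠ 0) :
    qInf q (q / (q ^ n * x)) =
      (-1) ^ n * (q ^ (n * (n - 1) / 2))⁻¹ * (x ^ n)⁻¹ * (qInf q (q / x) * qPoch q x n) := by
  let c (n : ℤ) : ℂ := (-1) ^ n * (q ^ (n * (n - 1) / 2))⁻¹ * (x ^ n)⁻¹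
  have c_succ (n : ℤ) : c (n + 1) = -(q ^ n * x)⁻¹ * c n := by
    simp only [c, triangle_add_one, zpow_add₀ hq0, zpow_add_one₀ hx,
      zpow_add_one₀ (neg_ne_zero.mpr (one_ne_zero (α := ℂ))), mul_inv]
    ring
  have qInf_succ (n : ℤ) : qInf q (q / (q ^ (n + 1) * x)) =
      -(q ^ n * x)⁻¹ * (1 - x * q ^ n) * qInf q (q / (q ^ n * x)) := by
    have : q ^ n * x ≠ 0 := mul_ne_zero (zpow_ne_zero _ hq0) hx
    rw [show q ^ (n + 1) * x = q * (q ^ n * x) by rw [zpow_add_one₀ hq0]; ring,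
      div_mul_cancel_left₀ hq0, qInf_eq_one_sub_mul hq, ← div_eq_mul_inv, mul_comm x]
    field_simp
    ring
  change _ = c n * _
  induction n using Int.induction_on with
  | zero => simp [c, qPoch_zero]
  | succ n ih =>
    rw [qInf_succ, ih fun j hj hnj => by lia, qPoch_add_one fun hn => by lia, c_succ]
    ring
  | pred n ih =>
    obtain ⟨m, hm⟩ : ∃ m, m = -(n : ℤ) - 1 := ⟨_, rfl⟩
    have hm0 : 1 - x * q ^ m ≠ 0 := h m (by lia) (by lia)
    have hqx : -(q ^ m * x)⁻¹ ≠ 0 :=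
      neg_ne_zero.mpr (inv_ne_zero (mul_ne_zero (zpow_ne_zero _ hq0) hx))
    have ih := ih fun j hj hnj => h j hj (by lia)
    rw [show -(n : ℤ) = m + 1 by lia, qInf_succ, qPoch_add_one fun _ => hm0, c_succ] at ih
    rw [← hm]
    refine mul_left_cancel₀ (mul_ne_zero hqx hm0) (ih.trans ?_)
    ring

end ShiftedFactorial

section Theta

theorem differentiableOn_compl_zero_tsum {ι : Type*} {F : ι → ℂ → ℂ}
    (hF : ∀ i, DifferentiableOn ℂ (F i) {0}ᶜ)
    (hbound : ∀ M : ℝ, ∃ u : ι → ℝ, Summable u ∧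
      ∀ i, ∀ t ≠ 0, ‖t‖ ≤ M → ‖t⁻¹‖ ≤ M → ‖F i t‖ ≤ u i) :
    DifferentiableOn ℂ (fun t => ∑' i, F i t) {0}ᶜ := by
  intro x hx
  obtain ⟨M, hM⟩ : ∃ M, max ‖x‖ ‖x⁻¹‖ < M := exists_gt _
  obtain ⟨u, hu, hle⟩ := hbound M
  let U : Set ℂ := {0}ᶜ ∩ (fun t => max ‖t‖ ‖t⁻¹‖) ⁻¹' Set.Iio M
  have hU : IsOpen U := (continuousOn_id.norm.sup
    continuousOn_inv₀.norm).isOpen_inter_preimage isOpen_compl_singleton isOpen_Iio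
  have hdiff : DifferentiableOn ℂ (fun t => ∑' i, F i t) U :=
    Complex.differentiableOn_tsum_of_summable_norm hu
      (fun i => (hF i).mono Set.inter_subset_left) hU fun i t ht =>
        hle i t ht.1 ((le_max_left _ _).trans (le_of_lt ht.2))
          ((le_max_right _ _).trans (le_of_lt ht.2))
  exact (hdiff.differentiableAt (hU.mem_nhds ⟨hx, hM⟩)).differentiableWithinAt

variable {q x : ℂ}

theorem qTheta_q_mul (hq : q ≠ 0) (hx : x ≠ 0) : qTheta q (q * x) = -x⁻¹ * qTheta q x := by
  unfold qTheta
  rw [← mul_div_assoc, ← tsum_mul_left]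
  congr 1
  conv_rhs => rw [← (Equiv.addRight (1 : ℤ)).tsum_eq]
  refine tsum_congr fun n => ?_
  rw [Equiv.coe_addRight, triangle_add_one, zpow_add₀ hq, zpow_add_one₀ hx, mul_zpow,
    zpow_add_one₀ (neg_ne_zero.mpr one_ne_zero)]
  field_simp

theorem qTheta_inv (hx : x ≠ 0) : qTheta q x⁻¹ = -x⁻¹ * qTheta q x := by
  unfold qTheta
  rw [← mul_div_assoc, ← tsum_mul_left]
  congr 1
  conv_rhs => rw [← (Equiv.subLeft (1 : ℤ)).tsum_eq]
  refine tsum_congr fun n => ?_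
  have neg_one_zpow : (-1 : ℂ) ^ (1 - n) = -(-1) ^ n := by
    rw [zpow_sub₀ (neg_ne_zero.mpr one_ne_zero), zpow_one, neg_div, one_div, ← inv_zpow,
      inv_neg_one]
  rw [Equiv.subLeft_apply, show (1 - n) * (1 - n - 1) = n * (n - 1) by ring, neg_one_zpow,
    zpow_sub₀ hx, zpow_one, inv_zpow]
  field_simp

theorem qTheta_one (q : ℂ) : qTheta q 1 = 0 := by
  have h := qTheta_inv (q := q) (one_ne_zero (α := ℂ))
  rwa [inv_one, neg_one_mul, self_eq_neg] at h

theorem summable_zpow_triangle_mul_pow {r M : ℝ} (hr0 : 0 < r) (hr : r < 1) (hM : 0 < M) :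
    Summable fun n : ℤ => r ^ (n * (n - 1) / 2) * M ^ n.natAbs := by
  have hnat : Summable fun n : ℕ => r ^ ((n : ℤ) * (n - 1) / 2) * M ^ n := by
    have pos (n : ℕ) : 0 < r ^ ((n : ℤ) * (n - 1) / 2) * M ^ n := by positivity
    refine summable_of_ratio_test_tendsto_lt_one one_pos (.of_forall fun n => (pos n).ne') ?_
    have hlim : Tendsto (fun n : ℕ => r ^ n * M) atTop (𝓝 0) := by
      simpa using (tendsto_pow_atTop_nhds_zero_of_lt_one hr0.le hr).mul_const M
    refine hlim.congr fun n => ?_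
    rw [Real.norm_of_nonneg (pos _).le, Real.norm_of_nonneg (pos _).le, eq_div_iff (pos n).ne',
      Nat.cast_succ, triangle_add_one, zpow_add₀ hr0.ne', zpow_natCast]
    ring
  refine .of_nat_of_neg (by simpa using hnat) (hnat.of_nonneg_of_le (fun n => by positivity)
    fun n => ?_)
  rw [Int.natAbs_neg, Int.natAbs_natCast]
  gcongr ?_ * _
  refine zpow_le_zpow_right_of_le_one₀ hr0 hr.le (Int.ediv_le_ediv two_pos ?_)
  nlinarith

theorem norm_zpow_le_pow_natAbs {M : ℝ} (h : ‖x‖ ≤ M) (h' : ‖x⁻¹‖ ≤ M) (n : ℤ) :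
    ‖x ^ n‖ ≤ M ^ n.natAbs := by
  obtain hn | hn := Int.natAbs_eq n
  · rw [hn, zpow_natCast, Int.natAbs_natCast, norm_pow]
    gcongr
  · rw [hn, zpow_neg, zpow_natCast, Int.natAbs_neg, Int.natAbs_natCast, ← inv_pow, norm_pow]
    gcongr

theorem differentiableOn_qTheta (hq0 : q ≠ 0) (hq : ‖q‖ < 1) :
    DifferentiableOn ℂ (qTheta q) {0}ᶜ := by
  refine (differentiableOn_compl_zero_tsum (fun n t ht =>
    ((differentiableAt_zpow.mpr (.inl ht)).const_mul _).differentiableWithinAt)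
    fun M => ?_).div_const _
  refine ⟨_, summable_zpow_triangle_mul_pow (norm_pos_iff.mpr hq0) hq (M := max M 1) (by simp),
    fun n t _ h h' => ?_⟩
  rw [norm_mul, norm_mul, norm_zpow, norm_neg, norm_one, one_zpow, one_mul, norm_zpow]
  gcongr
  exact norm_zpow_le_pow_natAbs (h.trans (le_max_left _ _)) (h'.trans (le_max_left _ _)) n

/-- The product `(x; q)_∞ (q / x; q)_∞`. It equals `θ(x)` by the Jacobi triple product, but only
the functional equations common to both functions are needed. -/
noncomputable def thetaProd (q x : ℂ) : ℂ := qInf q x * qInf q (q / x)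

theorem thetaProd_eq_one_sub_mul (hq : ‖q‖ < 1) (x : ℂ) :
    thetaProd q x = (1 - x) * qInfList q [q * x, q / x] := by
  simp [thetaProd, qInfList, qInf_eq_one_sub_mul hq x, mul_assoc]

theorem thetaProd_q_mul (hq0 : q ≠ 0) (hq : ‖q‖ < 1) (hx : x ≠ 0) :
    thetaProd q (q * x) = -x⁻¹ * thetaProd q x := by
  rw [thetaProd, thetaProd, div_mul_cancel_left₀ hq0, qInf_eq_one_sub_mul hq x,
    qInf_eq_one_sub_mul hq x⁻¹, ← div_eq_mul_inv]
  field_simp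
  ring

theorem thetaProd_inv (hq : ‖q‖ < 1) (hx : x ≠ 0) :
    thetaProd q x⁻¹ = -x⁻¹ * thetaProd q x := by
  rw [thetaProd, thetaProd, qInf_eq_one_sub_mul hq x, qInf_eq_one_sub_mul hq x⁻¹,
    ← div_eq_mul_inv, div_inv_eq_mul]
  field_simp
  ring

theorem differentiableOn_thetaProd (hq : ‖q‖ < 1) : DifferentiableOn ℂ (thetaProd q) {0}ᶜ :=
  (differentiable_qInf hq).differentiableOn.mul <|
    (differentiable_qInf hq).comp_differentiableOn <|
      (differentiableOn_const q).div differentiableOn_id fun _ hx => hx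

end Theta

section Laurent

open Real (circleAverage)

variable {f g : ℂ → ℂ}

theorem circleAverage_eq_circleAverage_of_differentiableOn (hf : DifferentiableOn ℂ f {0}ᶜ)
    {r R : ℝ} (hr : 0 < r) (hR : 0 < R) : circleAverage f 0 r = circleAverage f 0 R := by
  wlog hrR : r ≤ R generalizing r R
  · exact (this hR hr (le_of_not_ge hrR)).symm
  have ne_zero {z : ℂ} (hz : z ∉ Metric.ball 0 r) : z ≠ 0 :=
    fun h => hz (h ▸ Metric.mem_ball_self hr)
  rw [Real.circleAverage_eq_circleIntegral hr.ne', Real.circleAverage_eq_circleIntegral hR.ne']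
  congr 1
  refine (Complex.circleIntegral_sub_center_inv_smul_eq_of_differentiable_on_annulus_off_countable
    hr hrR Set.countable_empty (hf.continuousOn.mono fun z hz => ne_zero hz.2)
    fun z hz => hf.differentiableAt (isOpen_compl_singleton.mem_nhds ?_)).symm
  exact ne_zero fun h => hz.1.2 (Metric.ball_subset_closedBall h)

theorem circleAverage_congr_of_ne_zero (h : ∀ ξ ≠ 0, f ξ = g ξ) :
    circleAverage f 0 1 = circleAverage g 0 1 :=
  Real.circleAverage_congr_sphere fun ξ hξ => h ξ <| by
    rintro rfl
    simp at hξ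

theorem circleAverage_comp_mul_left (f : ℂ → ℂ) (v : ℂ) :
    circleAverage (fun ξ => f (v * ξ)) 0 1 = circleAverage f 0 ‖v‖ := by
  rw [Real.circleAverage_def, Real.circleAverage_eq_integral_add v.arg]
  congr 2 with θ
  congr 1
  rw [circleMap_zero, circleMap_zero, Complex.ofReal_one, one_mul]
  conv_lhs => rw [← Complex.norm_mul_exp_arg_mul_I v]
  push_cast
  rw [add_mul, Complex.exp_add]
  ring

/-- The coefficient of `ξ ^ m` in the Laurent expansion of `f` on `ℂ \ {0}`, read off on the unit
circle. -/
noncomputable def laurentCoeff (f : ℂ → ℂ) (m : ℤ) : ℂ :=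
  circleAverage (fun ξ => ξ ^ (-m) * f ξ) 0 1

theorem laurentCoeff_congr (h : ∀ ξ ≠ 0, f ξ = g ξ) (m : ℤ) :
    laurentCoeff f m = laurentCoeff g m :=
  circleAverage_congr_of_ne_zero fun ξ hξ => congrArg _ (h ξ hξ)

theorem differentiableOn_zpow_mul (hf : DifferentiableOn ℂ f {0}ᶜ) (m : ℤ) :
    DifferentiableOn ℂ (fun ξ => ξ ^ m * f ξ) {0}ᶜ :=
  (differentiableOn_zpow m _ (.inl (by simp))).mul hf

theorem laurentCoeff_add (hf : DifferentiableOn ℂ f {0}ᶜ) (hg : DifferentiableOn ℂ g {0}ᶜ)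
    (m : ℤ) : laurentCoeff (f + g) m = laurentCoeff f m + laurentCoeff g m := by
  have integrable {f : ℂ → ℂ} (hf : DifferentiableOn ℂ f {0}ᶜ) :
      CircleIntegrable (fun ξ => ξ ^ (-m) * f ξ) 0 1 :=
    ((differentiableOn_zpow_mul hf (-m)).continuousOn.mono fun ξ hξ => by
      rintro rfl
      simp at hξ).circleIntegrable zero_le_one
  rw [laurentCoeff, laurentCoeff, laurentCoeff,
    ← Real.circleAverage_fun_add (integrable hf) (integrable hg)]
  simp only [Pi.add_apply, mul_add]

theorem laurentCoeff_smul (c : ℂ) (f : ℂ → ℂ) (m : ℤ) :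
    laurentCoeff (c • f) m = c • laurentCoeff f m := by
  rw [laurentCoeff, laurentCoeff, ← Real.circleAverage_fun_smul]
  simp only [Pi.smul_apply, smul_eq_mul, mul_left_comm]

theorem laurentCoeff_zpow_mul (f : ℂ → ℂ) (k m : ℤ) :
    laurentCoeff (fun ξ => ξ ^ k * f ξ) m = laurentCoeff f (m - k) :=
  circleAverage_congr_of_ne_zero fun ξ hξ => by
    rw [← mul_assoc, ← zpow_add₀ hξ, neg_sub', sub_neg_eq_add]

theorem laurentCoeff_comp_inv (f : ℂ → ℂ) (m : ℤ) :
    laurentCoeff (fun ξ => f ξ⁻¹) m = laurentCoeff f (-m) := by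
  rw [laurentCoeff, laurentCoeff, ← Real.circleAverage_zero_one_congr_inv]
  simp only [inv_inv, inv_zpow', neg_neg]

theorem laurentCoeff_comp_mul_left (hf : DifferentiableOn ℂ f {0}ᶜ) {v : ℂ} (hv : v ≠ 0) (m : ℤ) :
    laurentCoeff (fun ξ => f (v * ξ)) m = v ^ m * laurentCoeff f m := by
  rw [laurentCoeff, laurentCoeff, circleAverage_eq_circleAverage_of_differentiableOn
    (differentiableOn_zpow_mul hf (-m)) one_pos (norm_pos_iff.mpr hv),
    ← circleAverage_comp_mul_left, ← smul_eq_mul, ← Real.circleAverage_fun_smul]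
  congr 1 with ξ
  rw [mul_zpow, smul_eq_mul, zpow_neg v]
  field_simp

open Real in
theorem eq_zero_of_circleAverage_zpow_mul_eq_zero (hf : ContinuousOn f {0}ᶜ)
    (h : ∀ m : ℤ, circleAverage (fun ξ => ξ ^ (-m) * f ξ) 0 1 = 0) : f 1 = 0 := by
  have : Fact (0 < 2 * π) := ⟨two_pi_pos⟩
  let F : C(AddCircle (2 * π), ℂ) :=
    ⟨fun x => f (AddCircle.toCircle x), hf.comp_continuous
      (continuous_subtype_val.comp AddCircle.continuous_toCircle) fun x => Circle.coe_ne_zero _⟩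
  have toCircle_eq (θ : ℝ) :
      (AddCircle.toCircle (θ : AddCircle (2 * π)) : ℂ) = circleMap 0 1 θ := by
    simp [AddCircle.toCircle_apply_mk, circleMap_zero]
  have hF : fourierCoeff F = 0 := by
    funext m
    rw [fourierCoeff_eq_intervalIntegral _ _ 0, zero_add, one_div]
    refine Eq.trans ?_ (h m)
    rw [circleAverage_def]
    congr 2 with θ
    rw [fourier_apply, AddCircle.toCircle_zsmul, Circle.coe_zpow, toCircle_eq, smul_eq_mul]
    change _ * f _ = _
    rw [toCircle_eq]
  have hsum := has_pointwise_sum_fourier_series_of_summable (f := F) (hF ▸ summable_zero) 0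
  simp only [hF, Pi.zero_apply, zero_smul] at hsum
  simpa [F] using hsum.unique hasSum_zero

theorem eq_zero_of_laurentCoeff_eq_zero (hf : DifferentiableOn ℂ f {0}ᶜ)
    (h : ∀ m, laurentCoeff f m = 0) {v : ℂ} (hv : v ≠ 0) : f v = 0 := by
  have hcont : ContinuousOn (fun ξ => f (v * ξ)) {0}ᶜ :=
    hf.continuousOn.comp (by fun_prop) fun ξ hξ => mul_ne_zero hv hξ
  simpa using eq_zero_of_circleAverage_zpow_mul_eq_zero hcont fun m =>
    (laurentCoeff_comp_mul_left hf hv m).trans (by rw [h, mul_zero])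

end Laurent

section SymmTheta

theorem int_forall_of_periodic_of_even {p : ℤ → Prop} {m : ℕ} (hm : 0 < m)
    (periodic : ∀ n, p (n + 2 * m) ↔ p n) (even : ∀ n, p (-n) ↔ p n) (h : ∀ k : ℕ, k ≤ m → p k)
    (n : ℤ) : p n := by
  have periodic' : Function.Periodic p (2 * m : ℤ) := fun n => propext (periodic n)
  have even_abs (n : ℤ) : p |n| ↔ p n := by
    obtain hn | hn := abs_choice n <;> simp only [hn, even]
  obtain ⟨k, hk⟩ : ∃ k : ℤ, |n - k * (2 * m)| ≤ m := by
    have hle := Int.le_bmod (x := n) (m := 2 * m) (by lia)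
    have hlt := Int.bmod_lt (x := n) (m := 2 * m) (by lia)
    refine ⟨n.bdiv (2 * m), ?_⟩
    rw [Int.bmod_eq_self_sub_bdiv_mul] at hle hlt
    push_cast at hle hlt
    exact abs_le.mpr ⟨by lia, by lia⟩
  rw [← periodic'.sub_zsmul_eq k, zsmul_eq_mul, Int.cast_id, ← even_abs]
  lift |n - k * (2 * m)| to ℕ using abs_nonneg _ with r
  exact h r (by exact_mod_cast hk)

/-- The space of symmetric theta functions of degree `m` and sign `ε`: functions `f` holomorphic
on `ℂ \ {0}` with `f (t) = (q t² / a) ^ m f (q t)` and `f (a / t) = ε f (t)`. In the customary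
normalization `a = 1`; keeping `a` as a parameter avoids a choice of `√a`. -/
noncomputable def symmTheta (q a ε : ℂ) (m : ℕ) : Submodule ℂ (ℂ → ℂ) where
  carrier := {f | DifferentiableOn ℂ f {0}ᶜ ∧ (∀ t ≠ 0, f t = (q * t ^ 2 / a) ^ m * f (q * t)) ∧
    ∀ t ≠ 0, f (a / t) = ε * f t}
  add_mem' := fun ⟨hd, hs, hi⟩ ⟨hd', hs', hi'⟩ => ⟨hd.add hd',
    fun t ht => by rw [Pi.add_apply, Pi.add_apply, hs t ht, hs' t ht, mul_add],
    fun t ht => by rw [Pi.add_apply, Pi.add_apply, hi t ht, hi' t ht, mul_add]⟩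
  zero_mem' := ⟨differentiableOn_const 0,
    fun _ _ => (mul_zero _).symm, fun _ _ => (mul_zero _).symm⟩
  smul_mem' := fun c f ⟨hd, hs, hi⟩ => ⟨hd.const_smul c,
    fun t ht => by rw [Pi.smul_apply, Pi.smul_apply, hs t ht, mul_smul_comm],
    fun t ht => by rw [Pi.smul_apply, Pi.smul_apply, hi t ht, mul_smul_comm]⟩

variable {q a ε ε' : ℂ} {m m' : ℕ} {f g : ℂ → ℂ}

namespace symmTheta

theorem mul_mem (hf : f ∈ symmTheta q a ε m) (hg : g ∈ symmTheta q a ε' m') :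
    f * g ∈ symmTheta q a (ε * ε') (m + m') := by
  refine ⟨hf.1.mul hg.1, fun t ht => ?_, fun t ht => ?_⟩
  · rw [Pi.mul_apply, Pi.mul_apply, hf.2.1 t ht, hg.2.1 t ht]
    ring
  · rw [Pi.mul_apply, Pi.mul_apply, hf.2.2 t ht, hg.2.2 t ht]
    ring

theorem prod_mem {κ : Type*} {F : κ → ℂ → ℂ} (s : Finset κ)
    (hF : ∀ k ∈ s, F k ∈ symmTheta q a 1 1) : ∏ k ∈ s, F k ∈ symmTheta q a 1 #s := by
  classical
  induction s using Finset.induction_on with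
  | empty => exact ⟨differentiableOn_const 1, by simp, by simp⟩
  | insert k s hk ih =>
    rw [prod_insert hk, card_insert_of_notMem hk, add_comm, ← one_mul (1 : ℂ)]
    exact mul_mem (hF k (mem_insert_self k s)) (ih fun j hj => hF j (mem_insert_of_mem hj))

theorem laurentCoeff_add_two_mul (hq : q ≠ 0) (hf : f ∈ symmTheta q a ε m) (n : ℤ) :
    laurentCoeff f (n + 2 * m) = (q / a) ^ m * q ^ n * laurentCoeff f n := by
  have hshift : laurentCoeff f (n + 2 * m) =
      laurentCoeff ((q / a) ^ m • fun t => t ^ (2 * m : ℤ) * f (q * t)) (n + 2 * m) := by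
    refine laurentCoeff_congr (fun t ht => ?_) _
    rw [hf.2.1 t ht, Pi.smul_apply, smul_eq_mul, zpow_mul, zpow_natCast]
    norm_cast
    ring
  rw [hshift, laurentCoeff_smul, laurentCoeff_zpow_mul (fun t => f (q * t)), add_sub_cancel_right,
    laurentCoeff_comp_mul_left hf.1 hq, smul_eq_mul, mul_assoc]

theorem laurentCoeff_neg (ha : a ≠ 0) (hf : f ∈ symmTheta q a ε m) (n : ℤ) :
    laurentCoeff f (-n) = ε * a ^ n * laurentCoeff f n := by
  have hinv : a ^ (-n) * laurentCoeff f (-n) = ε * laurentCoeff f n := by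
    rw [← laurentCoeff_comp_mul_left hf.1 ha, ← laurentCoeff_comp_inv fun t => f (a * t),
      ← smul_eq_mul ε, ← laurentCoeff_smul]
    exact laurentCoeff_congr hf.2.2 n
  rw [mul_right_comm, ← hinv, mul_right_comm, ← zpow_add₀ ha, neg_add_cancel, zpow_zero, one_mul]

theorem eq_zero_of_laurentCoeff_eq_zero {N : ℕ} (hq : q ≠ 0) (ha : a ≠ 0)
    (hf : f ∈ symmTheta q a (-1) (N + 1)) (h : ∀ k : Fin N, laurentCoeff f (k + 1) = 0) {t : ℂ}
    (ht : t ≠ 0) : f t = 0 := by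
  have shift (n : ℤ) := laurentCoeff_add_two_mul hq hf n
  have neg (n : ℤ) := laurentCoeff_neg ha hf n
  have periodic (n : ℤ) : laurentCoeff f (n + 2 * (N + 1 : ℕ)) = 0 ↔ laurentCoeff f n = 0 := by
    rw [shift]
    simp [hq, ha, zpow_ne_zero]
  have even (n : ℤ) : laurentCoeff f (-n) = 0 ↔ laurentCoeff f n = 0 := by
    simp [neg, ha, zpow_ne_zero]
  have coeff_zero : laurentCoeff f 0 = 0 := by simpa [self_eq_neg] using neg 0
  have coeff_last : laurentCoeff f (N + 1 : ℕ) = 0 := by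
    have e := shift (-(N + 1 : ℕ))
    rw [neg, two_mul, neg_add_cancel_left, zpow_neg, zpow_natCast, zpow_natCast, div_pow] at e
    field_simp at e
    rwa [self_eq_neg] at e
  refine _root_.eq_zero_of_laurentCoeff_eq_zero hf.1
    (int_forall_of_periodic_of_even N.succ_pos periodic even fun k hk => ?_) ht
  obtain rfl | hk0 := k.eq_zero_or_pos
  · exact coeff_zero
  obtain rfl | hkN := hk.eq_or_lt
  · exact coeff_last
  · have hk1 := h ⟨k - 1, by lia⟩
    rwa [Nat.cast_pred hk0, sub_add_cancel] at hk1

/-- The Laurent coefficients of indices `1, …, N`. -/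
noncomputable def coeffs (q a ε : ℂ) (m N : ℕ) : symmTheta q a ε m →ₗ[ℂ] Fin N → ℂ where
  toFun f k := laurentCoeff f (k + 1)
  map_add' f g := funext fun _ => laurentCoeff_add f.2.1 g.2.1 _
  map_smul' c f := funext fun _ => laurentCoeff_smul c f _

theorem eq_sum_of_apply_eq_zero {κ : Type*} [Fintype κ] (hq : q ≠ 0) (ha : a ≠ 0)
    (hf : f ∈ symmTheta q a (-1) (Fintype.card κ + 1)) {F : κ → ℂ → ℂ}
    (hF : ∀ k, F k ∈ symmTheta q a (-1) (Fintype.card κ + 1)) {y : κ → ℂ} (hy : ∀ k, y k ≠ 0)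
    (hF0 : ∀ j k, j ≠ k → F k (y j) = 0) (hF1 : ∀ k, F k (y k) ≠ 0) {t : ℂ} (ht : t ≠ 0) :
    f t = ∑ k, f (y k) * (F k t / F k (y k)) := by
  let L := coeffs q a (-1) (Fintype.card κ + 1) (Fintype.card κ)
  let G (k : κ) : symmTheta q a (-1) (Fintype.card κ + 1) := ⟨F k, hF k⟩
  have apply_eq_zero {u : symmTheta q a (-1) (Fintype.card κ + 1)} (hu : L u = 0) {s : ℂ}
      (hs : s ≠ 0) : (u : ℂ → ℂ) s = 0 :=
    eq_zero_of_laurentCoeff_eq_zero hq ha u.2 (congrFun hu) hs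
  have comb_apply (c : κ → ℂ) (s : ℂ) :
      ((∑ k, c k • G k : symmTheta q a (-1) (Fintype.card κ + 1)) : ℂ → ℂ) s =
        ∑ k, c k * F k s := by
    simp [G, Finset.sum_apply]
  have sum_node (c : κ → ℂ) (k : κ) : ∑ j, c j * F j (y k) = c k * F k (y k) :=
    sum_eq_single k (fun j _ hj => by rw [hF0 k j hj.symm, mul_zero]) (by simp)
  have hindep : LinearIndependent ℂ fun k => L (G k) := by
    refine Fintype.linearIndependent_iff.mpr fun c hc k => ?_
    have h0 := apply_eq_zero (u := ∑ k, c k • G k) (by simpa using hc) (hy k)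
    rw [comb_apply, sum_node] at h0
    exact (mul_eq_zero.mp h0).resolve_right (hF1 k)
  obtain ⟨c, hc⟩ : ∃ c : κ → ℂ, ∑ k, c k • L (G k) = L ⟨f, hf⟩ := by
    rw [← Submodule.mem_span_range_iff_exists_fun ℂ,
      hindep.span_eq_top_of_card_eq_finrank' (by simp)]
    trivial
  have hfc {s : ℂ} (hs : s ≠ 0) : f s = ∑ k, c k * F k s := by
    have h0 := apply_eq_zero (u := ⟨f, hf⟩ - ∑ k, c k • G k) (by simp [hc]) hs
    rw [← comb_apply, ← sub_eq_zero]
    exact h0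
  rw [hfc ht]
  refine sum_congr rfl fun k _ => ?_
  rw [hfc (hy k), sum_node, mul_assoc, mul_div_cancel₀ _ (hF1 k)]

end symmTheta

end SymmTheta

section ThetaPair

variable {q a : ℂ}

/-- The function `t ↦ θ(t y / a) θ(y / t)`, the symmetric theta function of degree `1` that
vanishes at `t = y`. -/
noncomputable def thetaPair (q a y t : ℂ) : ℂ := qTheta q (t * y / a) * qTheta q (y / t)

theorem thetaPair_self {y : ℂ} (hy : y ≠ 0) : thetaPair q a y y = 0 := by
  rw [thetaPair, div_self hy, qTheta_one, mul_zero]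

theorem thetaPair_mem_symmTheta {y : ℂ} (hq0 : q ≠ 0) (hq : ‖q‖ < 1) (ha : a ≠ 0) (hy : y ≠ 0) :
    thetaPair q a y ∈ symmTheta q a 1 1 := by
  have hdiff := differentiableOn_qTheta hq0 hq
  refine ⟨DifferentiableOn.mul (hdiff.comp (by fun_prop) fun t ht => ?_)
    (hdiff.comp (fun t ht => ?_) fun t ht => ?_), fun t ht => ?_, fun t _ => ?_⟩
  · exact div_ne_zero (mul_ne_zero ht hy) ha
  · exact ((differentiableAt_const y).div differentiableAt_id ht).differentiableWithinAt
  · exact div_ne_zero hy ht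
  · have hshift := qTheta_q_mul hq0 (div_ne_zero hy (mul_ne_zero hq0 ht))
    rw [← mul_div_assoc, mul_div_mul_left y t hq0] at hshift
    rw [thetaPair, thetaPair, hshift, mul_assoc q, mul_div_assoc q (t * y),
      qTheta_q_mul hq0 (div_ne_zero (mul_ne_zero ht hy) ha)]
    field_simp
  · rw [thetaPair, thetaPair, one_mul, mul_comm, div_mul_eq_mul_div, div_div_eq_mul_div,
      div_right_comm (a * y), mul_div_cancel_left₀ y ha, mul_comm y]

theorem inv_mul_thetaProd_mem_symmTheta (hq0 : q ≠ 0) (hq : ‖q‖ < 1) (ha : a ≠ 0) :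
    (fun t => t⁻¹ * thetaProd q (t ^ 2 / a)) ∈ symmTheta q a (-1) 2 := by
  refine ⟨differentiableOn_inv.mul ((differentiableOn_thetaProd hq).comp (by fun_prop)
    fun t ht => div_ne_zero (pow_ne_zero 2 ht) ha), fun t ht => ?_, fun t ht => ?_⟩
  · have hu : t ^ 2 / a ≠ 0 := div_ne_zero (pow_ne_zero 2 ht) ha
    beta_reduce
    rw [show (q * t) ^ 2 / a = q * (q * (t ^ 2 / a)) by ring,
      thetaProd_q_mul hq0 hq (mul_ne_zero hq0 hu), thetaProd_q_mul hq0 hq hu]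
    field_simp
  · beta_reduce
    rw [show (a / t) ^ 2 / a = (t ^ 2 / a)⁻¹ by field_simp,
      thetaProd_inv hq (div_ne_zero (pow_ne_zero 2 ht) ha)]
    field_simp

end ThetaPair

section LatticeSum

/-- The `n`-th term of the Poincaré series that averages `G` over the group `q ^ ℤ`, acting on
symmetric theta functions of degree `m`. -/
noncomputable def latticeTerm (q a : ℂ) (m : ℕ) (G : ℂ → ℂ) (n : ℤ) (t : ℂ) : ℂ :=
  (q ^ n * t ^ 2 / a) ^ (m * n) * G (q ^ n * t)

variable {q a : ℂ} {m : ℕ} {G : ℂ → ℂ}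

theorem latticeTerm_div (hq : q ≠ 0) (ha : a ≠ 0) (hG : ∀ t ≠ 0, G (a / t) = -G t) (n : ℤ) {t : ℂ}
    (ht : t ≠ 0) : latticeTerm q a m G n (a / t) = -latticeTerm q a m G (-n) t := by
  have hn : q ^ n ≠ 0 := zpow_ne_zero n hq
  have harg : q ^ n * (a / t) = a / (q ^ (-n) * t) := by
    rw [zpow_neg]
    field_simp
  have hweight : (q ^ n * (a / t) ^ 2 / a) = (q ^ (-n) * t ^ 2 / a)⁻¹ := by
    rw [zpow_neg]
    field_simp
  rw [latticeTerm, latticeTerm, harg, hweight, hG _ (mul_ne_zero (zpow_ne_zero _ hq) ht), mul_neg,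
    mul_neg, inv_zpow']

theorem latticeTerm_q_mul (hq : q ≠ 0) (ha : a ≠ 0) (n : ℤ) {t : ℂ} (ht : t ≠ 0) :
    (q * t ^ 2 / a) ^ m * latticeTerm q a m G n (q * t) = latticeTerm q a m G (n + 1) t := by
  have hu : q ^ (n + 1) * t ^ 2 / a ≠ 0 :=
    div_ne_zero (mul_ne_zero (zpow_ne_zero _ hq) (pow_ne_zero 2 ht)) ha
  have hweight : q * t ^ 2 / a * (q ^ n * (q * t) ^ 2 / a) ^ n =
      (q ^ (n + 1) * t ^ 2 / a) ^ (n + 1) := by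
    rw [show q ^ n * (q * t) ^ 2 / a = q * (q ^ (n + 1) * t ^ 2 / a) by
      rw [zpow_add_one₀ hq]; ring, mul_zpow, zpow_add_one₀ hu, zpow_add_one₀ hq]
    ring
  rw [latticeTerm, latticeTerm, ← mul_assoc, mul_comm (m : ℤ), mul_comm (m : ℤ), zpow_mul, zpow_mul,
    zpow_natCast, zpow_natCast, ← mul_pow, hweight, zpow_add_one₀ hq,
    mul_assoc _ q t]

theorem summable_comp_natAbs {u : ℕ → ℝ} (hu : Summable u) : Summable fun n : ℤ => u n.natAbs :=
  .of_nat_of_neg (by simpa using hu) (by simpa using hu)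

theorem exists_summable_norm_latticeTerm_le (hq : q ≠ 0) (ha : a ≠ 0)
    (hG : ∀ t ≠ 0, G (a / t) = -G t)
    (hbound : ∀ M : ℝ, ∃ u : ℕ → ℝ, Summable u ∧
      ∀ n : ℕ, ∀ t ≠ 0, ‖t‖ ≤ M → ‖t⁻¹‖ ≤ M → ‖latticeTerm q a m G n t‖ ≤ u n) (M : ℝ) :
    ∃ u : ℤ → ℝ, Summable u ∧
      ∀ n : ℤ, ∀ t ≠ 0, ‖t‖ ≤ M → ‖t⁻¹‖ ≤ M → ‖latticeTerm q a m G n t‖ ≤ u n := by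
  obtain ⟨u, hu, hle⟩ := hbound (max M (max (‖a‖ * M) (‖a⁻¹‖ * M)))
  refine ⟨_, summable_comp_natAbs hu, fun n t ht h h' => ?_⟩
  obtain hn | hn := Int.natAbs_eq n
  · rw [hn, Int.natAbs_natCast]
    exact hle _ t ht (h.trans (le_max_left _ _)) (h'.trans (le_max_left _ _))
  · rw [hn, Int.natAbs_neg, Int.natAbs_natCast, ← norm_neg, ← latticeTerm_div hq ha hG _ ht]
    refine hle _ _ (div_ne_zero ha ht) (le_max_of_le_right (le_max_of_le_left ?_))
      (le_max_of_le_right (le_max_of_le_right ?_))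
    · rw [div_eq_mul_inv, norm_mul]
      gcongr
    · rw [inv_div, div_eq_inv_mul, norm_mul]
      gcongr

theorem symmTheta.tsum_latticeTerm_mem (hq : q ≠ 0) (ha : a ≠ 0) (hd : DifferentiableOn ℂ G {0}ᶜ)
    (hG : ∀ t ≠ 0, G (a / t) = -G t)
    (hbound : ∀ M : ℝ, ∃ u : ℤ → ℝ, Summable u ∧
      ∀ n : ℤ, ∀ t ≠ 0, ‖t‖ ≤ M → ‖t⁻¹‖ ≤ M → ‖latticeTerm q a m G n t‖ ≤ u n) :
    (fun t => ∑' n : ℤ, latticeTerm q a m G n t) ∈ symmTheta q a (-1) m := by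
  refine ⟨differentiableOn_compl_zero_tsum (fun n => ?_) hbound, fun t ht => ?_, fun t ht => ?_⟩
  · have hqn (t : ℂ) (ht : t ≠ 0) : q ^ n * t ≠ 0 := mul_ne_zero (zpow_ne_zero n hq) ht
    refine DifferentiableOn.mul (DifferentiableOn.zpow (by fun_prop) (.inl fun t ht => ?_))
      (hd.comp (by fun_prop) hqn)
    exact div_ne_zero (mul_ne_zero (zpow_ne_zero n hq) (pow_ne_zero 2 ht)) ha
  · rw [← tsum_mul_left]
    refine ((Equiv.addRight (1 : ℤ)).tsum_eq fun n => latticeTerm q a m G n t).symm.trans ?_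
    exact tsum_congr fun n => (latticeTerm_q_mul hq ha n ht).symm
  · rw [← tsum_mul_left]
    refine ((Equiv.neg ℤ).tsum_eq fun n => latticeTerm q a m G n (a / t)).symm.trans ?_
    refine tsum_congr fun n => ?_
    rw [Equiv.neg_apply, latticeTerm_div hq ha hG _ ht, neg_one_mul, Int.neg_neg]

end LatticeSum

section VeryWellPoised

theorem qOmega_pair (q u v : ℂ) (l : List ℂ) :
    qOmega q [u, v] l = (l.map fun y => qInf q (u / y) * qInf q (v / y)).prod := by
  simp [qOmega, List.prod_map_mul]

theorem qOmega_swap (q u v : ℂ) (l : List ℂ) : qOmega q [u, v] l = qOmega q [v, u] l := by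
  simp [qOmega, mul_comm]

/-- The function whose average over `q ^ ℤ` is the very-well-poised series with parameters `l`, up
to the factors that make it holomorphic in the base point. -/
noncomputable def vwpKernel (q a : ℂ) (l : List ℂ) (u : ℂ) : ℂ :=
  u⁻¹ * (1 - u ^ 2 / a) * qOmega q [a * q / u, u * q] l

variable {q a : ℂ} {l : List ℂ}

theorem vwpKernel_div (ha : a ≠ 0) {u : ℂ} (hu : u ≠ 0) :
    vwpKernel q a l (a / u) = -vwpKernel q a l u := by
  rw [vwpKernel, vwpKernel, qOmega_swap, show a * q / (a / u) = u * q by field_simp,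
    div_mul_eq_mul_div]
  field_simp
  ring

theorem differentiableOn_list_prod {ι : Type*} {F : ι → ℂ → ℂ} {s : Set ℂ} (l : List ι)
    (hF : ∀ i, DifferentiableOn ℂ (F i) s) :
    DifferentiableOn ℂ (fun u => (l.map fun i => F i u).prod) s := by
  induction l with
  | nil => simp
  | cons i l ih => simpa only [List.map_cons, List.prod_cons] using (hF i).fun_mul ih

theorem differentiableOn_vwpKernel (hq : ‖q‖ < 1) :
    DifferentiableOn ℂ (vwpKernel q a l) {0}ᶜ := by
  have hinv : DifferentiableOn ℂ (fun u : ℂ => u⁻¹) {0}ᶜ := differentiableOn_inv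
  refine DifferentiableOn.mul (hinv.mul (by fun_prop)) ?_
  simp only [qOmega_pair]
  refine differentiableOn_list_prod l fun y => ?_
  have hqInf := differentiable_qInf hq
  refine DifferentiableOn.mul (hqInf.comp_differentiableOn ?_) (by fun_prop)
  simpa only [div_eq_mul_inv] using (hinv.const_mul (a * q)).mul_const y⁻¹

theorem qOmega_zpow_mul {t : ℂ} (hq0 : q ≠ 0) (hq : ‖q‖ < 1) (ha : a ≠ 0) (hl : ∀ y ∈ l, y ≠ 0)
    (ht : t ≠ 0) {n : ℤ} (h : ∀ y ∈ l, ∀ j < 0, n ≤ j → 1 - t * y / a * q ^ j ≠ 0) :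
    qOmega q [a * q / (q ^ n * t), q ^ n * t * q] l =
      ((-1) ^ n * (q ^ (n * (n - 1) / 2))⁻¹ * ((t / a) ^ n)⁻¹) ^ l.length * (l.prod ^ n)⁻¹ *
      (l.map fun y => qInf q (a * q / t / y) * qPoch q (t * y / a) n *
        qInf q (q ^ n * (t * q / y))).prod := by
  rw [qOmega_pair, List.prod_zpow, ← List.prod_replicate, ← List.map_const', List.prod_inv,
    List.map_map, ← List.prod_map_mul, ← List.prod_map_mul]
  refine congrArg List.prod (List.map_congr_left fun y hy => ?_)
  have hy0 := hl y hy
  have hx : t * y / a ≠ 0 := div_ne_zero (mul_ne_zero ht hy0) ha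
  have hreverse := qInf_div_zpow_mul hq0 hq hx (h y hy)
  rw [show q / (q ^ n * (t * y / a)) = a * q / (q ^ n * t) / y by field_simp,
    show q / (t * y / a) = a * q / t / y by field_simp, show t * y / a = t / a * y by ring,
    mul_zpow, mul_inv] at hreverse
  rw [hreverse, Function.comp_apply, show t * y / a = t / a * y by ring,
    show q ^ n * t * q / y = q ^ n * (t * q / y) by ring]
  ring

theorem zpow_mul_reversal_sq {t : ℂ} (hq0 : q ≠ 0) (ha : a ≠ 0) (ht : t ≠ 0) (n : ℤ) :
    (q ^ n * t ^ 2 / a) ^ n * ((-1) ^ n * (q ^ (n * (n - 1) / 2))⁻¹ * ((t / a) ^ n)⁻¹) ^ 2 =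
      (q * a) ^ n := by
  have neg_one_sq : ((-1 : ℂ) ^ n) ^ 2 = 1 := by
    rw [← zpow_natCast, zpow_comm]
    norm_num
  have triangle_sq : (q ^ n) ^ n = (q ^ (n * (n - 1) / 2)) ^ 2 * q ^ n := by
    have hT := Int.ediv_mul_cancel (Int.even_mul_pred_self n).two_dvd
    rw [← zpow_natCast, ← zpow_mul, ← zpow_mul, ← zpow_add₀ hq0]
    congr 1
    push_cast
    linear_combination -hT
  have hT : q ^ (n * (n - 1) / 2) ≠ 0 := zpow_ne_zero _ hq0
  have hat : t / a ≠ 0 := div_ne_zero ht ha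
  rw [show q ^ n * t ^ 2 / a = q ^ n * (a * (t / a) ^ 2) by field_simp, mul_zpow, mul_zpow,
    mul_pow, mul_pow, neg_one_sq, triangle_sq, mul_zpow q, ← zpow_natCast (t / a) 2,
    zpow_comm (t / a)]
  have := zpow_ne_zero n hat
  push_cast
  field_simp

theorem latticeTerm_vwpKernel {N : ℕ} {t w : ℂ} (hq0 : q ≠ 0) (hq : ‖q‖ < 1) (ha : a ≠ 0)
    (hl : ∀ y ∈ l, y ≠ 0) (hlen : l.length = 2 * (N + 1))
    (hw : w = q ^ N * a ^ (N + 1) / l.prod) (ht : t ≠ 0) {n : ℤ}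
    (h : ∀ y ∈ l, ∀ j < 0, n ≤ j → 1 - t * y / a * q ^ j ≠ 0) :
    latticeTerm q a (N + 1) (vwpKernel q a l) n t =
      w ^ n * (t⁻¹ * (1 - t ^ 2 / a * q ^ (2 * n))) *
      (l.map fun y => qInf q (a * q / t / y) * qPoch q (t * y / a) n *
        qInf q (q ^ n * (t * q / y))).prod := by
  rw [latticeTerm, vwpKernel, qOmega_zpow_mul hq0 hq ha hl ht h, hlen, hw]
  have hqn : q ^ n ≠ 0 := zpow_ne_zero n hq0
  have hweight : (q ^ n * t ^ 2 / a) ^ ((N + 1 : ℕ) * n) *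
      ((-1) ^ n * (q ^ (n * (n - 1) / 2))⁻¹ * ((t / a) ^ n)⁻¹) ^ (2 * (N + 1)) * (q ^ n)⁻¹ =
        (q ^ N * a ^ (N + 1)) ^ n := by
    rw [mul_comm _ n, zpow_mul, zpow_natCast, pow_mul _ 2, ← mul_pow,
      zpow_mul_reversal_sq hq0 ha ht, ← zpow_natCast, zpow_comm, zpow_natCast, mul_pow, pow_succ q,
      mul_right_comm, mul_zpow _ q, mul_inv_cancel_right₀ hqn]
  have hsq : (q ^ n * t) ^ 2 / a = t ^ 2 / a * q ^ (2 * n) := by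
    rw [zpow_mul' q, zpow_ofNat]
    ring
  rw [div_zpow (q ^ N * _), ← hweight, hsq, mul_inv (q ^ n)]
  generalize (q ^ n * t ^ 2 / a) ^ ((N + 1 : ℕ) * n) = W
  ring

theorem norm_list_prod_map_le {ι : Type*} {F : ι → ℂ} {B : ι → ℝ} (l : List ι)
    (h : ∀ i ∈ l, ‖F i‖ ≤ B i) : ‖(l.map F).prod‖ ≤ (l.map B).prod := by
  rw [List.norm_prod, List.map_map]
  exact List.prod_map_le_prod_map₀ _ _ (fun i _ => norm_nonneg (F i)) h

theorem norm_pow_le_one (hq : ‖q‖ < 1) (n : ℕ) : ‖q ^ n‖ ≤ 1 := by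
  rw [norm_pow]
  exact pow_le_one₀ (norm_nonneg q) hq.le

theorem norm_qInf_mul_qPoch_mul_qInf_le {M : ℝ} {t : ℂ} (hq : ‖q‖ < 1) (y : ℂ) (n : ℕ)
    (h : ‖t‖ ≤ M) (h' : ‖t⁻¹‖ ≤ M) :
    ‖qInf q (a * q / t / y) * qPoch q (t * y / a) n * qInf q (q ^ (n : ℤ) * (t * q / y))‖ ≤
      Real.exp (‖a‖ * M / ‖y‖ / (1 - ‖q‖)) * Real.exp (M * ‖y‖ / ‖a‖ / (1 - ‖q‖)) *
        Real.exp (M / ‖y‖ / (1 - ‖q‖)) := by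
  have : 0 < 1 - ‖q‖ := sub_pos.mpr hq
  have : 0 ≤ M := (norm_nonneg t).trans h
  rw [norm_mul, norm_mul]
  gcongr
  · refine (norm_qInf_le hq _).trans ?_
    gcongr
    calc ‖a * q / t / y‖ = ‖a‖ * ‖q‖ * ‖t⁻¹‖ / ‖y‖ := by
          rw [norm_div, norm_div, norm_mul, norm_inv, div_eq_mul_inv _ ‖t‖]
      _ ≤ ‖a‖ * 1 * M / ‖y‖ := by gcongr
      _ = ‖a‖ * M / ‖y‖ := by rw [mul_one]
  · refine (norm_prod_one_sub_mul_pow_le hq _ n).trans ?_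
    rw [norm_div, norm_mul]
    gcongr
  · refine (norm_qInf_le hq _).trans ?_
    gcongr
    calc ‖q ^ (n : ℤ) * (t * q / y)‖ = ‖q ^ (n + 1)‖ * ‖t‖ / ‖y‖ := by
          rw [zpow_natCast, ← norm_mul, ← norm_div]
          ring_nf
      _ ≤ 1 * M / ‖y‖ := by
          gcongr
          exact norm_pow_le_one hq _
      _ = M / ‖y‖ := by rw [one_mul]

theorem exists_norm_latticeTerm_vwpKernel_le {N : ℕ} {w : ℂ} (hq0 : q ≠ 0) (hq : ‖q‖ < 1)
    (ha : a ≠ 0) (hl : ∀ y ∈ l, y ≠ 0) (hlen : l.length = 2 * (N + 1))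
    (hw : w = q ^ N * a ^ (N + 1) / l.prod) (M : ℝ) :
    ∃ C, ∀ n : ℕ, ∀ t ≠ 0, ‖t‖ ≤ M → ‖t⁻¹‖ ≤ M →
      ‖latticeTerm q a (N + 1) (vwpKernel q a l) n t‖ ≤ C * ‖w‖ ^ n := by
  refine ⟨M * (1 + M ^ 2 / ‖a‖) * (l.map fun y => Real.exp (‖a‖ * M / ‖y‖ / (1 - ‖q‖)) *
    Real.exp (M * ‖y‖ / ‖a‖ / (1 - ‖q‖)) * Real.exp (M / ‖y‖ / (1 - ‖q‖))).prod,
    fun n t ht h h' => ?_⟩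
  have hM : 0 ≤ M := (norm_nonneg t).trans h
  rw [latticeTerm_vwpKernel hq0 hq ha hl hlen hw ht fun y _ j hj hnj => by lia, zpow_natCast,
    mul_assoc, norm_mul, norm_mul, norm_mul, norm_pow, mul_comm]
  gcongr ?_ * ?_ * ?_ * _
  · calc ‖1 - t ^ 2 / a * q ^ (2 * (n : ℤ))‖ ≤ ‖(1 : ℂ)‖ + ‖t ^ 2 / a * q ^ (2 * (n : ℤ))‖ :=
          norm_sub_le _ _
      _ = 1 + ‖t‖ ^ 2 / ‖a‖ * ‖q ^ (2 * n)‖ := by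
          rw [norm_one, norm_mul, norm_div, norm_pow]
          norm_cast
      _ ≤ 1 + M ^ 2 / ‖a‖ * 1 := by
          gcongr
          exact norm_pow_le_one hq _
      _ = 1 + M ^ 2 / ‖a‖ := by rw [mul_one]
  · exact norm_list_prod_map_le l fun y _ => norm_qInf_mul_qPoch_mul_qInf_le hq y n h h'

theorem exists_summable_norm_latticeTerm_vwpKernel_le {N : ℕ} {w : ℂ} (hq0 : q ≠ 0) (hq : ‖q‖ < 1)
    (ha : a ≠ 0) (hl : ∀ y ∈ l, y ≠ 0) (hlen : l.length = 2 * (N + 1))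
    (hw : w = q ^ N * a ^ (N + 1) / l.prod) (hw1 : ‖w‖ < 1) (M : ℝ) :
    ∃ u : ℤ → ℝ, Summable u ∧ ∀ n : ℤ, ∀ t ≠ 0, ‖t‖ ≤ M → ‖t⁻¹‖ ≤ M →
      ‖latticeTerm q a (N + 1) (vwpKernel q a l) n t‖ ≤ u n := by
  refine exists_summable_norm_latticeTerm_le hq0 ha (fun u hu => vwpKernel_div ha hu)
    (fun M => ?_) M
  obtain ⟨C, hC⟩ := exists_norm_latticeTerm_vwpKernel_le hq0 hq ha hl hlen hw M
  exact ⟨_, (summable_geometric_of_lt_one (norm_nonneg w) hw1).mul_left C, hC⟩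

end VeryWellPoised

theorem list_prod_map_div {ι M : Type*} [DivisionCommMonoid M] (l : List ι) (F G : ι → M) :
    (l.map fun i => F i / G i).prod = (l.map F).prod / (l.map G).prod :=
  Multiset.prod_map_div (m := (l : Multiset ι))

namespace VwpPsiDefined

variable {q A : ℂ} {L : List ℂ}

theorem exists_sq_eq (hq0 : q ≠ 0) (hA : A ≠ 0) (hψ : VwpPsiDefined q A L) :
    ∃ r, r ^ 2 = A ∧ vwpUpper q A L = q * r :: q * -r :: L ∧
      vwpLower q A L = r :: -r :: L.map (fun y => A * q / y) ∧
      ∀ j : ℤ, 1 - r * q ^ j ≠ 0 ∧ 1 - -r * q ^ j ≠ 0 := by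
  obtain ⟨r, hr⟩ : ∃ r, r = A ^ (1 / 2 : ℂ) := ⟨_, rfl⟩
  have hr2 : r ^ 2 = A := by
    rw [hr, one_div]
    exact Complex.cpow_ofNat_inv_pow A 2
  have hr0 : r ≠ 0 := by
    rintro rfl
    exact hA (by rw [← hr2, zero_pow two_ne_zero])
  have upper : vwpUpper q A L = q * r :: q * -r :: L := by rw [vwpUpper, ← hr, mul_neg]
  have lower : vwpLower q A L = r :: -r :: L.map (fun y => A * q / y) := by
    rw [vwpLower, upper, List.map_cons, List.map_cons, ← hr2]
    congr 2 <;> field_simp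
  obtain ⟨hupper, hlower⟩ := hψ
  rw [upper] at hupper
  rw [lower] at hlower
  have one_sub_ne_zero {v : ℂ} (hqv : q * v ∈ q * r :: q * -r :: L)
      (hv : v ∈ r :: -r :: L.map (fun y => A * q / y)) (j : ℤ) : 1 - v * q ^ j ≠ 0 := by
    rcases j with j | j
    · simpa using hlower v hv j
    · have := hupper _ hqv (j + 1)
      rwa [pow_succ' q (j + 1), mul_inv, mul_mul_mul_comm, mul_inv_cancel₀ hq0, one_mul,
        ← zpow_negSucc] at this
  exact ⟨r, hr2, upper, lower, fun j =>
    ⟨one_sub_ne_zero (by simp) (by simp) j, one_sub_ne_zero (by simp) (by simp) j⟩⟩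

theorem one_sub_ne_zero (hq0 : q ≠ 0) (hA : A ≠ 0) (hψ : VwpPsiDefined q A L) : 1 - A ≠ 0 := by
  obtain ⟨r, rfl, -, -, hr⟩ := hψ.exists_sq_eq hq0 hA
  rw [show 1 - r ^ 2 = (1 - r) * (1 - -r) by ring]
  simpa using hr 0

theorem upper_ne_zero (hψ : VwpPsiDefined q A L) {y : ℂ} (hy : y ∈ L) {j : ℤ} (hj : j < 0) :
    1 - y * q ^ j ≠ 0 := by
  obtain ⟨j, rfl⟩ := Int.eq_negSucc_of_lt_zero hj
  rw [zpow_negSucc]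
  exact hψ.1 y (List.mem_cons_of_mem _ (List.mem_cons_of_mem _ hy)) j

theorem lower_ne_zero (hψ : VwpPsiDefined q A L) {y : ℂ} (hy : y ∈ L) (j : ℕ) :
    1 - A * q / y * q ^ j ≠ 0 :=
  hψ.2 _ (List.mem_map_of_mem (List.mem_cons_of_mem _ (List.mem_cons_of_mem _ hy))) j

theorem vwpPsiTerm_eq (hq0 : q ≠ 0) (hq : ‖q‖ < 1) (hA : A ≠ 0) (hψ : VwpPsiDefined q A L) (w : ℂ)
    (n : ℤ) : vwpPsiTerm q A L w n = (1 - A * q ^ (2 * n)) / (1 - A) *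
      (L.map fun y => qPoch q y n / qPoch q (A * q / y) n).prod * w ^ n := by
  obtain ⟨r, rfl, hupper, hlower, hr⟩ := hψ.exists_sq_eq hq0 hA
  have factor_sqrt : qPoch q (q * r) n / qPoch q r n * (qPoch q (q * -r) n / qPoch q (-r) n) =
      (1 - r ^ 2 * q ^ (2 * n)) / (1 - r ^ 2) := by
    rw [qPoch_q_mul_div_qPoch hq0 hq (fun j => (hr j).1),
      qPoch_q_mul_div_qPoch hq0 hq (fun j => (hr j).2), div_mul_div_comm, zpow_mul' q, zpow_ofNat]
    ring
  simp only [vwpPsiTerm, psiTerm, qPochList, hupper, hlower, List.map_cons, List.prod_cons,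
    List.map_map, Function.comp_def]
  rw [← factor_sqrt, mul_div_mul_comm, mul_div_mul_comm, mul_assoc (_ / _) (_ / _),
    list_prod_map_div]

end VwpPsiDefined

section VeryWellPoisedLattice

variable {q a t w : ℂ} {l : List ℂ} {N : ℕ}

theorem qOmega_ne_zero (hq0 : q ≠ 0) (hq : ‖q‖ < 1) (ha : a ≠ 0) (hl : ∀ y ∈ l, y ≠ 0) (ht : t ≠ 0)
    (hψ : VwpPsiDefined q (t ^ 2 / a) (l.map fun y => t * y / a)) :
    qOmega q [a * q / t, t * q] l ≠ 0 := by
  rw [qOmega_pair]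
  refine List.prod_ne_zero fun h0 => ?_
  obtain ⟨y, hy, h0⟩ := List.mem_map.mp h0
  have hy0 := hl y hy
  have hmem := List.mem_map_of_mem (f := fun y => t * y / a) hy
  refine mul_ne_zero (qInf_ne_zero hq fun j hj => ?_) (qInf_ne_zero hq fun j hj => ?_) h0
  · refine hψ.upper_ne_zero hmem (j := -(j + 1 : ℕ)) (by lia) ?_
    rw [zpow_neg, zpow_natCast]
    have := pow_ne_zero (j + 1) hq0
    field_simp at hj ⊢
    linear_combination -hj
  · refine hψ.lower_ne_zero hmem j ?_
    rwa [show t ^ 2 / a * q / (t * y / a) = t * q / y by field_simp]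

theorem latticeTerm_vwpKernel_eq_mul_vwpPsiTerm (hq0 : q ≠ 0) (hq : ‖q‖ < 1) (ha : a ≠ 0)
    (hl : ∀ y ∈ l, y ≠ 0) (hlen : l.length = 2 * (N + 1))
    (hw : w = q ^ N * a ^ (N + 1) / l.prod) (ht : t ≠ 0)
    (hψ : VwpPsiDefined q (t ^ 2 / a) (l.map fun y => t * y / a)) (n : ℤ) :
    latticeTerm q a (N + 1) (vwpKernel q a l) n t =
      t⁻¹ * (1 - t ^ 2 / a) * qOmega q [a * q / t, t * q] l *
        vwpPsiTerm q (t ^ 2 / a) (l.map fun y => t * y / a) w n := by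
  have hA : t ^ 2 / a ≠ 0 := div_ne_zero (pow_ne_zero 2 ht) ha
  have hA1 := hψ.one_sub_ne_zero hq0 hA
  have hmem {y : ℂ} (hy : y ∈ l) := List.mem_map_of_mem (f := fun y => t * y / a) hy
  have factors : (l.map fun y => qInf q (a * q / t / y) * qPoch q (t * y / a) n *
      qInf q (q ^ n * (t * q / y))).prod = qOmega q [a * q / t, t * q] l *
        (l.map fun y => qPoch q (t * y / a) n / qPoch q (t ^ 2 / a * q / (t * y / a)) n).prod := by
    rw [qOmega_pair, ← List.prod_map_mul]
    refine congrArg List.prod (List.map_congr_left fun y hy => ?_)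
    have hy0 := hl y hy
    have hlower := hψ.lower_ne_zero (hmem hy)
    rw [show t ^ 2 / a * q / (t * y / a) = t * q / y by field_simp] at hlower ⊢
    rw [qInf_zpow_mul hq0 hq hlower]
    ring
  rw [latticeTerm_vwpKernel hq0 hq ha hl hlen hw ht fun y hy j hj _ =>
    hψ.upper_ne_zero (hmem hy) hj, factors, hψ.vwpPsiTerm_eq hq0 hq hA, List.map_map]
  simp only [Function.comp_def]
  generalize t ^ 2 / a = A at *
  field_simp

theorem summable_vwpPsiTerm (hq0 : q ≠ 0) (hq : ‖q‖ < 1) (ha : a ≠ 0) (hl : ∀ y ∈ l, y ≠ 0)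
    (hlen : l.length = 2 * (N + 1)) (hw : w = q ^ N * a ^ (N + 1) / l.prod) (hw1 : ‖w‖ < 1)
    (ht : t ≠ 0) (hψ : VwpPsiDefined q (t ^ 2 / a) (l.map fun y => t * y / a)) :
    Summable (vwpPsiTerm q (t ^ 2 / a) (l.map fun y => t * y / a) w) := by
  obtain ⟨u, hu, hle⟩ := exists_summable_norm_latticeTerm_vwpKernel_le hq0 hq ha hl hlen hw hw1
    (max ‖t‖ ‖t⁻¹‖)
  have hsum := Summable.of_norm_bounded hu
    fun n => hle n t ht (le_max_left _ _) (le_max_right _ _)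
  simp only [latticeTerm_vwpKernel_eq_mul_vwpPsiTerm hq0 hq ha hl hlen hw ht hψ] at hsum
  have hA1 := hψ.one_sub_ne_zero hq0 (div_ne_zero (pow_ne_zero 2 ht) ha)
  exact (summable_mul_left_iff (mul_ne_zero (mul_ne_zero (inv_ne_zero ht) hA1)
    (qOmega_ne_zero hq0 hq ha hl ht hψ))).mp hsum

theorem tsum_latticeTerm_vwpKernel (hq0 : q ≠ 0) (hq : ‖q‖ < 1) (ha : a ≠ 0)
    (hl : ∀ y ∈ l, y ≠ 0) (hlen : l.length = 2 * (N + 1))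
    (hw : w = q ^ N * a ^ (N + 1) / l.prod) (ht : t ≠ 0)
    (hψ : VwpPsiDefined q (t ^ 2 / a) (l.map fun y => t * y / a)) :
    ∑' n : ℤ, latticeTerm q a (N + 1) (vwpKernel q a l) n t =
      t⁻¹ * (1 - t ^ 2 / a) * qOmega q [a * q / t, t * q] l *
        vwpPsi q (t ^ 2 / a) (l.map fun y => t * y / a) w := by
  rw [vwpPsi, ← tsum_mul_left]
  exact tsum_congr (latticeTerm_vwpKernel_eq_mul_vwpPsiTerm hq0 hq ha hl hlen hw ht hψ)

end VeryWellPoisedLattice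

section Interpolation

variable {κ : Type*} [Fintype κ] [DecidableEq κ] {q a t : ℂ} {y : κ → ℂ}

/-- The analogue of the `k`-th Lagrange basis polynomial for the nodes `y`, not normalized: a
symmetric theta function of sign `-1` and degree `card κ + 1` that vanishes at `y j` for `j ≠ k`. -/
noncomputable def thetaNodal (q a : ℂ) (y : κ → ℂ) (k : κ) : ℂ → ℂ :=
  (fun t => t⁻¹ * thetaProd q (t ^ 2 / a)) * ∏ j ∈ univ.erase k, thetaPair q a (y j)

theorem thetaNodal_apply (k : κ) (t : ℂ) : thetaNodal q a y k t =
    t⁻¹ * thetaProd q (t ^ 2 / a) * ∏ j ∈ univ.erase k, thetaPair q a (y j) t := by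
  rw [thetaNodal, Pi.mul_apply, Finset.prod_apply]

theorem thetaNodal_node_of_ne (hy : ∀ k, y k ≠ 0) {j k : κ} (hjk : j ≠ k) :
    thetaNodal q a y k (y j) = 0 := by
  rw [thetaNodal_apply, prod_eq_zero (mem_erase.mpr ⟨hjk, mem_univ j⟩) (thetaPair_self (hy j)),
    mul_zero]

theorem thetaNodal_mem_symmTheta (hq0 : q ≠ 0) (hq : ‖q‖ < 1) (ha : a ≠ 0) (hy : ∀ k, y k ≠ 0)
    (k : κ) : thetaNodal q a y k ∈ symmTheta q a (-1) (Fintype.card κ + 1) := by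
  have hmem := symmTheta.mul_mem (inv_mul_thetaProd_mem_symmTheta hq0 hq ha)
    (symmTheta.prod_mem (univ.erase k) fun j _ => thetaPair_mem_symmTheta hq0 hq ha (hy j))
  have hdegree : 2 + #(univ.erase k) = Fintype.card κ + 1 := by
    have := card_erase_add_one (mem_univ k)
    rw [card_univ] at this
    lia
  rwa [hdegree, mul_one] at hmem

theorem symmTheta.eq_sum_thetaNodal {f : ℂ → ℂ} (hq0 : q ≠ 0) (hq : ‖q‖ < 1) (ha : a ≠ 0)
    (hf : f ∈ symmTheta q a (-1) (Fintype.card κ + 1)) (hy : ∀ k, y k ≠ 0)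
    (hθy : ∀ j k, j ≠ k → thetaPair q a (y k) (y j) ≠ 0) (hp : ∀ k, thetaProd q (y k ^ 2 / a) ≠ 0)
    (ht : t ≠ 0) :
    f t = ∑ k, f (y k) * (thetaNodal q a y k t / thetaNodal q a y k (y k)) := by
  refine eq_sum_of_apply_eq_zero hq0 ha hf (thetaNodal_mem_symmTheta hq0 hq ha hy) hy
    (fun j k => thetaNodal_node_of_ne hy) (fun k => ?_) ht
  rw [thetaNodal_apply]
  exact mul_ne_zero (mul_ne_zero (inv_ne_zero (hy k)) (hp k))
    (prod_ne_zero_iff.mpr fun j hj => hθy k j (ne_of_mem_erase hj).symm)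

end Interpolation

theorem mainTheorem5_general {κ : Type*} [Fintype κ] [DecidableEq κ] {q a w : ℂ} {l : List ℂ}
    {y : κ → ℂ} (hq0 : q ≠ 0) (hq : ‖q‖ < 1) (ha : a ≠ 0) (hy : ∀ k, y k ≠ 0)
    (hl : ∀ s ∈ l, s ≠ 0) (hlen : l.length = 2 * (Fintype.card κ + 1))
    (hw : w = q ^ Fintype.card κ * a ^ (Fintype.card κ + 1) / l.prod) (hw1 : ‖w‖ < 1)
    (hψ : VwpPsiDefined q a l)
    (hψy : ∀ k, VwpPsiDefined q (y k ^ 2 / a) (l.map fun s => y k * s / a))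
    (hθ : ∀ k, thetaPair q a (y k) a ≠ 0) (hθy : ∀ j k, j ≠ k → thetaPair q a (y k) (y j) ≠ 0)
    (hp : ∀ k, qInfList q [y k ^ 2 * q / a, a * q / y k ^ 2] ≠ 0) :
    Summable (vwpPsiTerm q a l w) ∧
    (∀ k, Summable (vwpPsiTerm q (y k ^ 2 / a) (l.map fun s => y k * s / a) w)) ∧
    qOmega q [q, a * q] l / (∏ k, thetaPair q a (y k) a) * vwpPsi q a l w =
      ∑ k, qInfList q [a * q, q / a] / qInfList q [y k ^ 2 * q / a, a * q / y k ^ 2] *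
        (qOmega q [a * q / y k, y k * q] l /
          (thetaPair q a (y k) a * ∏ j ∈ univ.erase k, thetaPair q a (y j) (y k))) *
        vwpPsi q (y k ^ 2 / a) (l.map fun s => y k * s / a) w := by
  have hbase : a ^ 2 / a = a := by rw [sq, mul_div_cancel_left₀ a ha]
  have hparams : (l.map fun s => a * s / a) = l := by simp [mul_div_cancel_left₀ _ ha]
  have hψa : VwpPsiDefined q (a ^ 2 / a) (l.map fun s => a * s / a) := by rwa [hbase, hparams]
  have hsummable := summable_vwpPsiTerm hq0 hq ha hl hlen hw hw1 ha hψa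
  have htsum := tsum_latticeTerm_vwpKernel hq0 hq ha hl hlen hw ha hψa
  rw [hbase, hparams] at hsummable htsum
  refine ⟨hsummable, fun k => summable_vwpPsiTerm hq0 hq ha hl hlen hw hw1 (hy k) (hψy k), ?_⟩
  have hA := hψ.one_sub_ne_zero hq0 ha
  have hAy (k : κ) := (hψy k).one_sub_ne_zero hq0 (div_ne_zero (pow_ne_zero 2 (hy k)) ha)
  have hthetaProd (k : κ) : thetaProd q (y k ^ 2 / a) =
      (1 - y k ^ 2 / a) * qInfList q [y k ^ 2 * q / a, a * q / y k ^ 2] := by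
    rw [thetaProd_eq_one_sub_mul hq, ← mul_div_assoc, div_div_eq_mul_div, mul_comm q, mul_comm q]
  have interpolation := symmTheta.eq_sum_thetaNodal hq0 hq ha
    (symmTheta.tsum_latticeTerm_mem hq0 ha (differentiableOn_vwpKernel hq)
      (fun u hu => vwpKernel_div ha hu)
      (exists_summable_norm_latticeTerm_vwpKernel_le hq0 hq ha hl hlen hw hw1)) hy hθy
    (fun k => hthetaProd k ▸ mul_ne_zero (hAy k) (hp k)) ha
  rw [htsum] at interpolation
  have hprod : ∏ k, thetaPair q a (y k) a ≠ 0 := prod_ne_zero_iff.mpr fun k _ => hθ k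
  refine mul_left_cancel₀ (mul_ne_zero (mul_ne_zero (inv_ne_zero ha) hA) hprod) ?_
  calc _ = a⁻¹ * (1 - a) * qOmega q [a * q / a, a * q] l * vwpPsi q a l w := by
        rw [mul_div_cancel_left₀ q ha]
        field_simp
    _ = _ := interpolation
    _ = _ := by
      rw [mul_sum]
      refine sum_congr rfl fun k _ => ?_
      rw [tsum_latticeTerm_vwpKernel hq0 hq ha hl hlen hw (hy k) (hψy k), thetaNodal_apply,
        thetaNodal_apply, hthetaProd, hbase, thetaProd_eq_one_sub_mul hq,
        ← mul_prod_erase _ _ (mem_univ k), mul_comm q a]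
      have := hy k
      have := hAy k
      have := hp k
      have := hθ k
      generalize y k ^ 2 / a = B, qInfList q _ = P at *
      field_simp

theorem vwpPsi_three_term {q a u v w : ℂ} {l : List ℂ} (hq0 : q ≠ 0) (hq : ‖q‖ < 1) (ha : a ≠ 0)
    (hu : u ≠ 0) (hv : v ≠ 0) (hl : ∀ s ∈ l, s ≠ 0) (hlen : l.length = 6)
    (hw : w = q ^ 2 * a ^ 3 / l.prod) (hw1 : ‖w‖ < 1) (hψ : VwpPsiDefined q a l)
    (hψu : VwpPsiDefined q (u ^ 2 / a) (l.map fun s => u * s / a))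
    (hψv : VwpPsiDefined q (v ^ 2 / a) (l.map fun s => v * s / a))
    (hθ : qThetaList q [u / a, v / a, u, v] ≠ 0)
    (hθu : qThetaList q [v / u, u, u / a, u * v / a] ≠ 0)
    (hθv : qThetaList q [u / v, v / a, u * v / a, v] ≠ 0)
    (hpu : qInfList q [u ^ 2 * q / a, a * q / u ^ 2] ≠ 0)
    (hpv : qInfList q [v ^ 2 * q / a, a * q / v ^ 2] ≠ 0) :
    Summable (vwpPsiTerm q a l w) ∧
    Summable (vwpPsiTerm q (u ^ 2 / a) (l.map fun s => u * s / a) w) ∧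
    Summable (vwpPsiTerm q (v ^ 2 / a) (l.map fun s => v * s / a) w) ∧
    qOmega q [q, a * q] l / qThetaList q [u / a, v / a, u, v] * vwpPsi q a l w =
      qInfList q [a * q, q / a] / qInfList q [u ^ 2 * q / a, a * q / u ^ 2] *
          (qOmega q [a * q / u, u * q] l / qThetaList q [v / u, u, u / a, u * v / a]) *
          vwpPsi q (u ^ 2 / a) (l.map fun s => u * s / a) w +
        qInfList q [a * q, q / a] / qInfList q [v ^ 2 * q / a, a * q / v ^ 2] *
          (qOmega q [v * q, a * q / v] l / qThetaList q [u / v, v / a, u * v / a, v]) *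
          vwpPsi q (v ^ 2 / a) (l.map fun s => v * s / a) w := by
  have hθ' : qThetaList q [u / a, v / a, u, v] = thetaPair q a u a * thetaPair q a v a := by
    simp only [qThetaList, List.map_cons, List.map_nil, List.prod_cons, List.prod_nil, mul_one,
      thetaPair, mul_div_cancel_left₀ _ ha]
    ring
  have hθu' : qThetaList q [v / u, u, u / a, u * v / a] =
      thetaPair q a u a * thetaPair q a v u := by
    simp only [qThetaList, List.map_cons, List.map_nil, List.prod_cons, List.prod_nil, mul_one,
      thetaPair, mul_div_cancel_left₀ _ ha]
    ring
  have hθv' : qThetaList q [u / v, v / a, u * v / a, v] =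
      thetaPair q a v a * thetaPair q a u v := by
    simp only [qThetaList, List.map_cons, List.map_nil, List.prod_cons, List.prod_nil, mul_one,
      thetaPair, mul_div_cancel_left₀ _ ha, mul_comm v u]
    ring
  rw [hθ'] at hθ ⊢
  rw [hθu'] at hθu ⊢
  rw [hθv'] at hθv ⊢
  rw [qOmega_swap q (v * q)]
  obtain ⟨h, hy, hsum⟩ := mainTheorem5_general (y := ![u, v]) hq0 hq ha
    (Fin.forall_fin_two.mpr ⟨hu, hv⟩) hl hlen hw hw1 hψ (Fin.forall_fin_two.mpr ⟨hψu, hψv⟩)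
    (Fin.forall_fin_two.mpr ⟨left_ne_zero_of_mul hθ, right_ne_zero_of_mul hθ⟩)
    (by simp [Fin.forall_fin_two, right_ne_zero_of_mul hθu, right_ne_zero_of_mul hθv])
    (Fin.forall_fin_two.mpr ⟨hpu, hpv⟩)
  have erase_zero : univ.erase (0 : Fin 2) = {1} := rfl
  have erase_one : univ.erase (1 : Fin 2) = {0} := rfl
  rw [Fin.sum_univ_two, Fin.prod_univ_two, erase_zero, erase_one, prod_singleton,
    prod_singleton] at hsum
  exact ⟨h, hy 0, hy 1, hsum⟩

theorem mainTheorem5 (q a b c d e h k x z w : ℂ)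
    (hq0 : 0 < ‖q‖) (hq1 : ‖q‖ < 1)
    (ha : a ≠ 0) (hb : b ≠ 0) (hc : c ≠ 0) (hd : d ≠ 0) (he : e ≠ 0) (hh : h ≠ 0) (hk : k ≠ 0)
    (hx : x ≠ 0) (hz : z ≠ 0)
    -- the common argument of the three series
    (hw : w = a ^ 3 * q ^ 2 / (b * c * d * e * h * k)) (hw1 : ‖w‖ < 1)
    -- the terms of the three series are well defined
    (hψ₁ : VwpPsiDefined q a [b, c, d, e, h, k])
    (hψ₂ : VwpPsiDefined q (b ^ 2 * x ^ 2 / a)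
      [b ^ 2 * x / a, b * c * x / a, b * d * x / a, b * e * x / a, b * h * x / a, b * k * x / a])
    (hψ₃ : VwpPsiDefined q (x ^ 2 * z ^ 2 / a)
      [b * x * z / a, c * x * z / a, d * x * z / a, e * x * z / a, h * x * z / a, k * x * z / a])
    -- the denominators of the three coefficients do not vanish
    (hθ₁ : qThetaList q [b * x / a, x * z / a, b * x, x * z] ≠ 0)
    (hθ₂ : qThetaList q [z / b, b * x, b * x / a, b * x ^ 2 * z / a] ≠ 0)
    (hθ₃ : qThetaList q [b / z, x * z / a, b * x ^ 2 * z / a, x * z] ≠ 0)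
    (hp₂ : qInfList q [b ^ 2 * x ^ 2 * q / a, a * q / (b ^ 2 * x ^ 2)] ≠ 0)
    (hp₃ : qInfList q [x ^ 2 * z ^ 2 * q / a, a * q / (x ^ 2 * z ^ 2)] ≠ 0) :
    Summable (vwpPsiTerm q a [b, c, d, e, h, k] w) ∧
    Summable (vwpPsiTerm q (b ^ 2 * x ^ 2 / a)
      [b ^ 2 * x / a, b * c * x / a, b * d * x / a, b * e * x / a, b * h * x / a, b * k * x / a]
      w) ∧
    Summable (vwpPsiTerm q (x ^ 2 * z ^ 2 / a)
      [b * x * z / a, c * x * z / a, d * x * z / a, e * x * z / a, h * x * z / a, k * x * z / a]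
      w) ∧
    qOmega q [q, a * q] [b, c, d, e, h, k] /
        qThetaList q [b * x / a, x * z / a, b * x, x * z] *
        vwpPsi q a [b, c, d, e, h, k] w =
      qInfList q [a * q, q / a] /
          qInfList q [b ^ 2 * x ^ 2 * q / a, a * q / (b ^ 2 * x ^ 2)] *
          (qOmega q [a * q / (b * x), b * q * x] [b, c, d, e, h, k] /
            qThetaList q [z / b, b * x, b * x / a, b * x ^ 2 * z / a]) *
          vwpPsi q (b ^ 2 * x ^ 2 / a)
            [b ^ 2 * x / a, b * c * x / a, b * d * x / a, b * e * x / a, b * h * x / a,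
              b * k * x / a] w +
        qInfList q [a * q, q / a] /
          qInfList q [x ^ 2 * z ^ 2 * q / a, a * q / (x ^ 2 * z ^ 2)] *
          (qOmega q [x * z * q, a * q / (x * z)] [b, c, d, e, h, k] /
            qThetaList q [b / z, x * z / a, b * x ^ 2 * z / a, x * z]) *
          vwpPsi q (x ^ 2 * z ^ 2 / a)
            [b * x * z / a, c * x * z / a, d * x * z / a, e * x * z / a, h * x * z / a,
              k * x * z / a] w := by
  have hdiv₂ : x * z / (b * x) = z / b := by rw [mul_comm b, mul_div_mul_left z b hx]
  have hdiv₃ : b * x / (x * z) = b / z := by rw [mul_comm b, mul_div_mul_left b z hx]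
  have hmul : b * x * (x * z) / a = b * x ^ 2 * z / a := by ring
  have hparams₂ : [b, c, d, e, h, k].map (fun s => b * x * s / a) =
      [b ^ 2 * x / a, b * c * x / a, b * d * x / a, b * e * x / a, b * h * x / a,
        b * k * x / a] := by
    simp only [List.map]
    ring_nf
  have hparams₃ : [b, c, d, e, h, k].map (fun s => x * z * s / a) =
      [b * x * z / a, c * x * z / a, d * x * z / a, e * x * z / a, h * x * z / a,
        k * x * z / a] := by
    simp only [List.map]
    ring_nf
  have hw' : w = q ^ 2 * a ^ 3 / [b, c, d, e, h, k].prod := by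
    simp only [hw, List.prod_cons, List.prod_nil, mul_one]
    ring
  rw [mul_right_comm b q x]
  simp only [← hparams₂, ← hparams₃, ← hdiv₂, ← hdiv₃, ← hmul, ← mul_pow] at *
  exact vwpPsi_three_term (norm_pos_iff.mp hq0) hq1 ha (mul_ne_zero hb hx) (mul_ne_zero hx hz)
    (by simp [*]) rfl hw' hw1 hψ₁ hψ₂ hψ₃ hθ₁ hθ₂ hθ₃ hp₂ hp₃
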